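/- \textbf{Theorem.} Let $m\ge 2$ be real, let $\log$ denote the base-2 logarithm, and let the square $[0,m]^2$ contain $\mathrm{Pois}(m^2)$ blue dots and, independently, $\mathrm{Pois}(m^2)$ red dots, where all dots are placed independently and uniformly at random in the square (so that the blue and the red dots form two independent Poisson processes of density $1$). Let $\mathcal P$ be the set of all monotone paths from $(0,0)$ to $(m,m)$, that is, continuous curves from $(0,0)$ to $(m,m)$ along which both coordinates are nondecreasing, and for $P\in\mathcal P$ let $\mathrm{surplus}(P)$ be the number of blue dots strictly beneath $P$ minus the number of red dots strictly beneath $P$. (The maximum of $\mathrm{surplus}(P)$ over $P\in\mathcal P$ is always attained.) (1) There are absolute constants $\alpha_0,c>0$ such that for all real $m\ge 2$ and all $\alpha\ge\alpha_0$, $$\Pr\Big[\max_{P\in\mathcal P}\mathrm{surplus}(P)\ \ge\ \alpha\, m\,\log^{0.75} m\Big]\ \le\ 2^{-c\,\alpha\log m}.$$ (2) The maximum surplus is integrable, and there is an absolute constant $C>0$ such that for all real $m\ge 2$, $$\mathbb E\Big[\max_{P\in\mathcal P}\mathrm{surplus}(P)\Big]\ \le\ C\, m\,\log^{0.75} m .$$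 -/

import Mathlib

open MeasureTheory ProbabilityTheory

noncomputable section

namespace PathSurplus

/-- The square grid `[0, m] × [0, m]`. -/
def grid (m : ℝ) : Set (ℝ × ℝ) := Set.Icc 0 m ×ˢ Set.Icc 0 m

/-- A finite family of dots of one colour: a number `n` and a sequence of positions, of which
only the first `n` are used. -/
abbrev Dots : Type := ℕ × (ℕ → ℝ × ℝ)

/-- The number of dots (with multiplicity) that lie in the region `A`. -/
def dotCount (D : Dots) (A : Set (ℝ × ℝ)) : ℕ := {i : ℕ | i < D.1 ∧ D.2 i ∈ A}.ncard

/-- Monotone paths from `(0, 0)` to `(m, m)`: continuous curves both of whose coordinates are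
nondecreasing. -/
def IsMonotonePath {m : ℝ} (γ : Path ((0, 0) : ℝ × ℝ) (m, m)) : Prop := Monotone γ

/-- The part of the grid that lies strictly beneath the path. -/
def beneath {m : ℝ} (γ : Path ((0, 0) : ℝ × ℝ) (m, m)) : Set (ℝ × ℝ) :=
  {p | p ∈ grid m ∧ ∀ t, (γ t).1 = p.1 → p.2 < (γ t).2}

/-- The surplus of a path: blue dots beneath it minus red dots beneath it. -/
def surplus {m : ℝ} (blue red : Dots) (γ : Path ((0, 0) : ℝ × ℝ) (m, m)) : ℤ :=
  (dotCount blue (beneath γ) : ℤ) - dotCount red (beneath γ)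

/-- The set of the surpluses of all monotone paths from `(0, 0)` to `(m, m)`. -/
def surplusValues (m : ℝ) (blue red : Dots) : Set ℤ :=
  {s | ∃ γ : Path ((0, 0) : ℝ × ℝ) (m, m), IsMonotonePath γ ∧ surplus blue red γ = s}

/-- The maximum surplus over all monotone paths from `(0, 0)` to `(m, m)`. -/
def maxSurplus (m : ℝ) (blue red : Dots) : ℤ := sSup (surplusValues m blue red)

/-- The supremum in `maxSurplus` is attained, so it is a maximum. -/
theorem isGreatest_maxSurplus {m : ℝ} (hm : 0 ≤ m) (blue red : Dots) :
    IsGreatest (surplusValues m blue red) (maxSurplus m blue red) := by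
  have hb : BddAbove (surplusValues m blue red) := by
    refine ⟨(blue.1 : ℤ), ?_⟩
    rintro s ⟨γ, -, rfl⟩
    have h : dotCount blue (beneath γ) ≤ blue.1 := by
      have h1 : {i : ℕ | i < blue.1 ∧ blue.2 i ∈ beneath γ} ⊆ ↑(Finset.range blue.1) := by
        intro i hi
        simpa using hi.1
      have h2 := Set.ncard_le_ncard h1 (Finset.finite_toSet _)
      rwa [Set.ncard_coe_finset, Finset.card_range] at h2
    unfold surplus
    omega
  have hne : (surplusValues m blue red).Nonempty := by
    let γ : Path ((0, 0) : ℝ × ℝ) (m, m) :=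
      { toFun := fun t => ((t : ℝ) * m, (t : ℝ) * m)
        continuous_toFun := by fun_prop
        source' := by simp
        target' := by simp }
    refine ⟨_, γ, ?_, rfl⟩
    intro s t hst
    have h : (s : ℝ) * m ≤ t * m := mul_le_mul_of_nonneg_right hst hm
    exact ⟨h, h⟩
  exact ⟨Int.csSup_mem hne hb, fun s hs => le_csSup hb hs⟩

/-- `D` is a random family of `Pois(m²)` many dots placed independently and uniformly at random
in the grid `[0, m] × [0, m]`, i.e. a Poisson process of density `1` on the grid. -/
structure IsPoissonDots {Ω : Type*} [MeasurableSpace Ω] (P : Measure Ω) (m : ℝ)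
    (D : Ω → Dots) : Prop where
  hasLaw_number : HasLaw (fun ω => (D ω).1) (poissonMeasure (m ^ 2).toNNReal) P
  hasLaw_position : ∀ i, HasLaw (fun ω => (D ω).2 i) (cond volume (grid m)) P
  iIndepFun_position : iIndepFun (fun (i : ℕ) ω => (D ω).2 i) P
  indepFun_number_position : IndepFun (fun ω => (D ω).1) (fun ω => (D ω).2) P

/-- The path surplus problem: blue and red dots, each a Poisson process of density `1` on the
grid `[0, m] × [0, m]`, independent of each other. -/
structure IsPathSurplusProblem {Ω : Type*} [MeasurableSpace Ω] (P : Measure Ω) (m : ℝ)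
    (blue red : Ω → Dots) : Prop where
  blue_dots : IsPoissonDots P m blue
  red_dots : IsPoissonDots P m red
  indepFun_blue_red : IndepFun blue red P

end PathSurplus

end

noncomputable section

namespace PathSurplus

section

/-! ### Exponential moments of Poisson dots -/

/-! In the area-preserving coordinates u = x + y and v = (y - x)/2, monotone paths become graphs of
1/2-Lipschitz functions vanishing at 0 and 2m (`exists_profile_of_path`, `exists_path_of_profile`).
The task is to bound a signed Poisson count uniformly over these functions, and this is done by
chaining with a cost adapted to each function.

At level k a profile is replaced by the piecewise linear function with mesh w_k = 2m/2^k whose node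
values are rounded down to multiples of δ w_k. Level k+1 arises from level k through integer
corrections (`code`), and the region between the two graphs has area at most 4δ w_{k+1}² times the
total size of the corrections (`volume_stepRegion_le`). Up to rounding, a correction is a change of
slope divided by δ. Squared changes of slope add up to increments of the mean square slope, which
never exceeds 1/4. Hence all levels share one energy budget, and ∑ cost_k / 2^k ≤ 5n + 1/δ²
(`sum_cost_code_le`).

In the union bound a code has weight exp(-(total size) - 2·(number of positions)), and these weights
sum to at most 1 (`measureReal_exists_code_le`). So the size of the corrections controls both the
variance and the entropy. Put l = (log m)^{1/4}, δ = l⁻² and use the Chernoff parameter θ_k = 2^k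
l/m at level k. The chain then contributes O((m/l)(n + l⁴)) = O(m l³) = O(m log^{3/4} m), apart from
the deviation term. It stops at 2^n ≈ m/l, the last level with θ_n ≤ 1; what remains is a band of
area O(m l), whose dots of both colours are simply counted. The result is
`IsPathSurplusProblem.tail`, and integrating this tail bounds the mean. -/

theorem lintegral_poissonMeasure_pow (r : NNReal) {c : ℝ} (hc : 0 ≤ c) :
    ∫⁻ n, ENNReal.ofReal c ^ n ∂(poissonMeasure r) = ENNReal.ofReal (Real.exp (r * (c - 1))) := by
  rw [poissonMeasure, lintegral_sum_measure]
  simp only [lintegral_smul_measure, lintegral_dirac, smul_eq_mul]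
  have h1 : ∀ n : ℕ, ENNReal.ofReal (Real.exp (-↑r) * ↑r ^ n / ↑n.factorial) *
      ENNReal.ofReal c ^ n = ENNReal.ofReal (Real.exp (-r) * ((r * c) ^ n / n.factorial)) := by
    intro n
    rw [← ENNReal.ofReal_pow hc, ← ENNReal.ofReal_mul (by positivity)]
    congr 1
    ring
  simp only [h1]
  have h2 : HasSum (fun n : ℕ => Real.exp (-r) * ((r * c) ^ n / n.factorial))
      (Real.exp (-r) * Real.exp (r * c)) := by
    have := NormedSpace.expSeries_div_hasSum_exp (r * c : ℝ)
    rw [← Real.exp_eq_exp_ℝ] at this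
    exact this.mul_left _
  rw [← ENNReal.ofReal_tsum_of_nonneg (fun n => by positivity) h2.summable, h2.tsum_eq,
    ← Real.exp_add]
  congr 2
  ring

variable {Ω : Type*} [MeasurableSpace Ω] {P : Measure Ω} {m : ℝ}

theorem IsPoissonDots.aemeasurable_position {D : Ω → Dots} (hD : IsPoissonDots P m D) :
    AEMeasurable (fun ω => (D ω).2) P :=
  aemeasurable_pi_iff.2 fun i => (hD.hasLaw_position i).aemeasurable

theorem IsPoissonDots.aemeasurable {D : Ω → Dots} (hD : IsPoissonDots P m D) :
    AEMeasurable D P :=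
  hD.hasLaw_number.aemeasurable.prodMk hD.aemeasurable_position

theorem measurable_prod_dots {F : ℝ × ℝ → ENNReal} (hF : Measurable F) :
    Measurable (fun D : Dots => ∏ i ∈ Finset.range D.1, F (D.2 i)) := by
  refine measurable_from_prod_countable_right fun n => ?_
  exact Finset.measurable_fun_prod (Finset.range n) fun i _ => by fun_prop

/-- Given n dots, the n independent factors have mean c^n; averaging over n gives the Poisson
generating function at c. -/
theorem IsPoissonDots.lintegral_prod [IsProbabilityMeasure P] {D : Ω → Dots}
    (hD : IsPoissonDots P m D) {F : ℝ × ℝ → ENNReal} (hF : Measurable F) {c : ℝ} (hc : 0 ≤ c)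
    (hFc : ∫⁻ p, F p ∂(cond volume (grid m)) = ENNReal.ofReal c) :
    ∫⁻ ω, ∏ i ∈ Finset.range (D ω).1, F ((D ω).2 i) ∂P =
      ENNReal.ofReal (Real.exp (m ^ 2 * (c - 1))) := by
  have hZ := hD.aemeasurable_position
  have hmap := (indepFun_iff_map_prod_eq_prod_map_map hD.hasLaw_number.aemeasurable hZ).1
    hD.indepFun_number_position
  have h1 : ∫⁻ ω, ∏ i ∈ Finset.range (D ω).1, F ((D ω).2 i) ∂P =
      ∫⁻ d : Dots, ∏ i ∈ Finset.range d.1, F (d.2 i)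
        ∂(Measure.map (fun ω => ((D ω).1, (D ω).2)) P) :=
    (lintegral_map' (measurable_prod_dots hF).aemeasurable hD.aemeasurable).symm
  have : IsProbabilityMeasure (P.map fun ω => (D ω).2) := Measure.isProbabilityMeasure_map hZ
  rw [h1, hmap, hD.hasLaw_number.map_eq,
    MeasureTheory.lintegral_prod _ (measurable_prod_dots hF).aemeasurable]
  have h2 : ∀ n : ℕ, ∫⁻ z, ∏ i ∈ Finset.range n, F (z i) ∂(P.map fun ω => (D ω).2) =
      ENNReal.ofReal c ^ n := by
    intro n
    have hFn : Measurable fun z : ℕ → ℝ × ℝ => ∏ i ∈ Finset.range n, F (z i) := by fun_prop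
    rw [lintegral_map' hFn.aemeasurable hZ]
    have hX := fun i => (hD.hasLaw_position i).aemeasurable
    -- The positions are only a.e. measurable, so they are replaced by measurable modifications
    -- before expectations of products are factorised.
    have hind : iIndepFun (fun i ω => F ((hX i).mk _ ω)) P :=
      (hD.iIndepFun_position.congr fun i => (hX i).ae_eq_mk).comp (fun _ => F) fun _ => hF
    have hae : ∀ᵐ ω ∂P, ∀ i, (D ω).2 i = (hX i).mk _ ω :=
      ae_all_iff.2 fun i => (hX i).ae_eq_mk
    have h3 : ∫⁻ ω, ∏ i ∈ Finset.range n, F ((D ω).2 i) ∂P =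
        ∫⁻ ω, ∏ i ∈ Finset.range n, F ((hX i).mk _ ω) ∂P :=
      lintegral_congr_ae (hae.mono fun ω hω => by simp only [hω])
    rw [h3, lintegral_prod_eq_prod_lintegral_of_indepFun _ (fun i ω => F ((hX i).mk _ ω)) hind
      fun i => hF.comp (hX i).measurable_mk]
    have h4 : ∀ i, ∫⁻ ω, F ((hX i).mk _ ω) ∂P = ENNReal.ofReal c := by
      intro i
      rw [← hFc, ← (hD.hasLaw_position i).map_eq, lintegral_map' hF.aemeasurable (hX i)]
      exact lintegral_congr_ae ((hX i).ae_eq_mk.mono fun ω hω => by simp only [hω])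
    simp [h4]
  simp only [h2]
  rw [lintegral_poissonMeasure_pow _ hc, Real.coe_toNNReal _ (sq_nonneg m)]

/-- The sum of a weight over the dots. -/
def dotSum (D : Dots) (f : ℝ × ℝ → ℝ) : ℝ := ∑ i ∈ Finset.range D.1, f (D.2 i)

theorem measurable_dotSum {f : ℝ × ℝ → ℝ} (hf : Measurable f) :
    Measurable (fun D : Dots => dotSum D f) := by
  refine measurable_from_prod_countable_right fun n => ?_
  exact Finset.measurable_fun_sum (Finset.range n) fun i _ => by fun_prop

theorem dotSum_indicator (D : Dots) (A : Set (ℝ × ℝ)) :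
    dotSum D (A.indicator 1) = dotCount D A := by
  classical
  have h : {i : ℕ | i < D.1 ∧ D.2 i ∈ A} = ↑((Finset.range D.1).filter fun i => D.2 i ∈ A) := by
    ext i; simp
  rw [dotCount, h, Set.ncard_coe_finset, Finset.card_filter, dotSum]
  push_cast
  exact Finset.sum_congr rfl fun i _ => by simp [Set.indicator_apply]

theorem dotSum_sub (D : Dots) (f g : ℝ × ℝ → ℝ) :
    dotSum D (fun p => f p - g p) = dotSum D f - dotSum D g :=
  Finset.sum_sub_distrib _ _

theorem lintegral_exp_dotSum [IsProbabilityMeasure P] {D : Ω → Dots}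
    (hD : IsPoissonDots P m D) {f : ℝ × ℝ → ℝ} (hf : Measurable f) {c : ℝ} (hc : 0 ≤ c)
    (hfc : ∫⁻ p, ENNReal.ofReal (Real.exp (f p)) ∂(cond volume (grid m)) = ENNReal.ofReal c) :
    ∫⁻ ω, ENNReal.ofReal (Real.exp (dotSum (D ω) f)) ∂P =
      ENNReal.ofReal (Real.exp (m ^ 2 * (c - 1))) := by
  rw [← hD.lintegral_prod (F := fun p => ENNReal.ofReal (Real.exp (f p))) (by fun_prop) hc hfc]
  refine lintegral_congr fun ω => ?_
  rw [dotSum, Real.exp_sum, ENNReal.ofReal_prod_of_nonneg fun _ _ => (Real.exp_pos _).le]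

theorem IsPathSurplusProblem.lintegral_exp [IsProbabilityMeasure P] {blue red : Ω → Dots}
    (h : IsPathSurplusProblem P m blue red) {f g : ℝ × ℝ → ℝ} (hf : Measurable f)
    (hg : Measurable g) {c d : ℝ} (hc : 0 ≤ c) (hd : 0 ≤ d)
    (hfc : ∫⁻ p, ENNReal.ofReal (Real.exp (f p)) ∂(cond volume (grid m)) = ENNReal.ofReal c)
    (hgd : ∫⁻ p, ENNReal.ofReal (Real.exp (g p)) ∂(cond volume (grid m)) = ENNReal.ofReal d) :
    ∫⁻ ω, ENNReal.ofReal (Real.exp (dotSum (blue ω) f + dotSum (red ω) g)) ∂P =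
      ENNReal.ofReal (Real.exp (m ^ 2 * (c + d - 2))) := by
  have hF : Measurable fun D : Dots => ENNReal.ofReal (Real.exp (dotSum D f)) :=
    (Real.measurable_exp.comp (measurable_dotSum hf)).ennreal_ofReal
  have hG : Measurable fun D : Dots => ENNReal.ofReal (Real.exp (dotSum D g)) :=
    (Real.measurable_exp.comp (measurable_dotSum hg)).ennreal_ofReal
  have hi := h.indepFun_blue_red.comp hF hG
  have := lintegral_mul_eq_lintegral_mul_lintegral_of_indepFun''
    (hF.comp_aemeasurable h.blue_dots.aemeasurable)
    (hG.comp_aemeasurable h.red_dots.aemeasurable) hi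
  simp only [Function.comp_apply] at this
  rw [lintegral_exp_dotSum h.blue_dots hf hc hfc, lintegral_exp_dotSum h.red_dots hg hd hgd,
    ← ENNReal.ofReal_mul (Real.exp_pos _).le, ← Real.exp_add] at this
  rw [show m ^ 2 * (c + d - 2) = m ^ 2 * (c - 1) + m ^ 2 * (d - 1) by ring, ← this]
  refine lintegral_congr fun ω => ?_
  rw [Real.exp_add, ENNReal.ofReal_mul (Real.exp_pos _).le]

theorem volume_grid (hm : 0 ≤ m) : volume (grid m) = ENNReal.ofReal (m ^ 2) := by
  rw [grid, Measure.volume_eq_prod, Measure.prod_prod, Real.volume_Icc, sub_zero,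
    ← ENNReal.ofReal_mul hm, sq]

theorem measurableSet_grid : MeasurableSet (grid m) := measurableSet_Icc.prod measurableSet_Icc

theorem isProbabilityMeasure_cond_grid (hm : 0 < m) :
    IsProbabilityMeasure (cond volume (grid m)) := by
  refine cond_isProbabilityMeasure_of_finite ?_ ?_
  · rw [volume_grid hm.le]; simp [hm.ne']
  · rw [volume_grid hm.le]; simp

theorem cond_grid_real {A : Set (ℝ × ℝ)} (hm : 0 < m) (hA : A ⊆ grid m) :
    m ^ 2 * (cond volume (grid m)).real A = volume.real A := by
  rw [measureReal_def, measureReal_def, cond_apply measurableSet_grid,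
    Set.inter_eq_self_of_subset_right hA, volume_grid hm.le, ENNReal.toReal_mul,
    ENNReal.toReal_inv, ENNReal.toReal_ofReal (sq_nonneg m)]
  field_simp

/-- This follows from cosh x ≤ exp(x²/2) ≤ 1 + x². -/
theorem exp_add_exp_neg_le {x : ℝ} (hx : |x| ≤ 1) :
    Real.exp x + Real.exp (-x) ≤ 2 + 2 * x ^ 2 := by
  have h1 := Real.cosh_le_exp_half_sq x
  rw [Real.cosh_eq] at h1
  have hx2 : x ^ 2 ≤ 1 := by rw [← sq_abs]; nlinarith [abs_nonneg x]
  have h2 := Real.abs_exp_sub_one_le (x := x ^ 2 / 2) (by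
    rw [abs_of_nonneg (by positivity)]; linarith)
  rw [abs_of_nonneg (a := x ^ 2 / 2) (by positivity)] at h2
  linarith [le_abs_self (Real.exp (x ^ 2 / 2) - 1)]

theorem exp_le_one_add_two_mul {x : ℝ} (h0 : 0 ≤ x) (hx : x ≤ 1) :
    Real.exp x ≤ 1 + 2 * x := by
  have h2 := Real.abs_exp_sub_one_le (x := x) (by rwa [abs_of_nonneg h0])
  rw [abs_of_nonneg h0] at h2
  linarith [le_abs_self (Real.exp x - 1)]

theorem lintegral_exp_eq_ofReal_integral {μ : Measure (ℝ × ℝ)} [IsFiniteMeasure μ]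
    {f : ℝ × ℝ → ℝ} (hf : Measurable f) (hb : ∀ p, |f p| ≤ 1) :
    Integrable (fun p => Real.exp (f p)) μ ∧
    ∫⁻ p, ENNReal.ofReal (Real.exp (f p)) ∂μ = ENNReal.ofReal (∫ p, Real.exp (f p) ∂μ) := by
  have hi : Integrable (fun p => Real.exp (f p)) μ := by
    refine Integrable.of_bound (by fun_prop) (Real.exp 1) (ae_of_all _ fun p => ?_)
    rw [Real.norm_eq_abs, Real.abs_exp]
    exact Real.exp_le_exp.2 (le_of_abs_le (hb p))
  exact ⟨hi, (ofReal_integral_eq_lintegral_ofReal hi (ae_of_all _ fun _ => (Real.exp_pos _).le)).symm⟩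

theorem integrable_add_mul_indicator {μ : Measure (ℝ × ℝ)} [IsFiniteMeasure μ]
    {A : Set (ℝ × ℝ)} (hA : MeasurableSet A) (a b : ℝ) :
    Integrable (fun p => a + b * A.indicator (1 : ℝ × ℝ → ℝ) p) μ :=
  (integrable_const _).add (((integrable_const (1 : ℝ)).indicator hA).const_mul b)

theorem integral_add_mul_indicator {μ : Measure (ℝ × ℝ)} [IsProbabilityMeasure μ]
    {A : Set (ℝ × ℝ)} (hA : MeasurableSet A) (a b : ℝ) :
    ∫ p, (a + b * A.indicator (1 : ℝ × ℝ → ℝ) p) ∂μ = a + b * μ.real A := by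
  have hi : Integrable (fun p => b * A.indicator (1 : ℝ × ℝ → ℝ) p) μ :=
    ((integrable_const (1 : ℝ)).indicator hA).const_mul b
  rw [integral_add (integrable_const _) hi, integral_const_mul, integral_indicator_one hA]
  simp

/-- Exponential moment of the surplus of a signed region supported on `A`. -/
theorem IsPathSurplusProblem.lintegral_exp_sub_le [IsProbabilityMeasure P] {blue red : Ω → Dots}
    (h : IsPathSurplusProblem P m blue red) (hm : 0 < m) {f : ℝ × ℝ → ℝ} (hf : Measurable f)
    {A : Set (ℝ × ℝ)} (hAm : MeasurableSet A) (hA : A ⊆ grid m) (hb : ∀ p, |f p| ≤ A.indicator 1 p)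
    {θ : ℝ} (h0 : 0 ≤ θ) (h1 : θ ≤ 1) :
    ∫⁻ ω, ENNReal.ofReal (Real.exp (θ * (dotSum (blue ω) f - dotSum (red ω) f))) ∂P ≤
      ENNReal.ofReal (Real.exp (2 * θ ^ 2 * volume.real A)) := by
  have := isProbabilityMeasure_cond_grid hm
  set μ := cond volume (grid m)
  have hb1 : ∀ p, |f p| ≤ 1 := fun p => (hb p).trans
    (Set.indicator_le_self' (fun _ _ => zero_le_one) p)
  have hb2 : ∀ p, |θ * f p| ≤ 1 := fun p => by
    rw [abs_mul, abs_of_nonneg h0]; nlinarith [hb1 p, abs_nonneg (f p)]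
  have hb3 : ∀ p, |-(θ * f p)| ≤ 1 := fun p => by rw [abs_neg]; exact hb2 p
  obtain ⟨i1, e1⟩ := lintegral_exp_eq_ofReal_integral (μ := μ) (f := fun p => θ * f p)
    (by fun_prop) hb2
  obtain ⟨i2, e2⟩ := lintegral_exp_eq_ofReal_integral (μ := μ) (f := fun p => -(θ * f p))
    (by fun_prop) hb3
  -- Red dots carry the opposite weight, so the linear terms cancel and the exponent becomes
  -- quadratic in `θ`.
  have key := h.lintegral_exp (f := fun p => θ * f p) (g := fun p => -(θ * f p)) (by fun_prop)
    (by fun_prop) (integral_nonneg fun _ => (Real.exp_pos _).le)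
    (integral_nonneg fun _ => (Real.exp_pos _).le) e1 e2
  have hs : ∀ ω, θ * (dotSum (blue ω) f - dotSum (red ω) f) =
      dotSum (blue ω) (fun p => θ * f p) + dotSum (red ω) (fun p => -(θ * f p)) := by
    intro ω
    simp only [dotSum, Finset.sum_neg_distrib, ← Finset.mul_sum]
    ring
  simp only [hs]
  rw [key]
  refine ENNReal.ofReal_le_ofReal (Real.exp_le_exp.2 ?_)
  rw [← cond_grid_real hm hA, ← integral_add i1 i2]
  have h2 : ∫ p, (Real.exp (θ * f p) + Real.exp (-(θ * f p))) ∂μ ≤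
      ∫ p, (2 + 2 * θ ^ 2 * A.indicator 1 p) ∂μ := by
    refine integral_mono (i1.add i2) (integrable_add_mul_indicator hAm _ _) fun p => ?_
    refine (exp_add_exp_neg_le (hb2 p)).trans ?_
    have h3 : f p ^ 2 ≤ A.indicator 1 p := by
      rw [← sq_abs]; nlinarith [hb p, hb1 p, abs_nonneg (f p)]
    nlinarith [mul_le_mul_of_nonneg_left h3 (sq_nonneg θ)]
  rw [integral_add_mul_indicator hAm] at h2
  nlinarith [mul_le_mul_of_nonneg_left h2 (sq_nonneg m)]

/-- Exponential moment of the number of dots of both colours in a region. -/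
theorem IsPathSurplusProblem.lintegral_exp_add_le [IsProbabilityMeasure P] {blue red : Ω → Dots}
    (h : IsPathSurplusProblem P m blue red) (hm : 0 < m)
    {A : Set (ℝ × ℝ)} (hAm : MeasurableSet A) (hA : A ⊆ grid m)
    {θ : ℝ} (h0 : 0 ≤ θ) (h1 : θ ≤ 1) :
    ∫⁻ ω, ENNReal.ofReal (Real.exp (θ * (dotSum (blue ω) (A.indicator 1) +
        dotSum (red ω) (A.indicator 1)))) ∂P ≤
      ENNReal.ofReal (Real.exp (4 * θ * volume.real A)) := by
  have := isProbabilityMeasure_cond_grid hm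
  set μ := cond volume (grid m)
  have hfm : Measurable fun p => θ * A.indicator (1 : ℝ × ℝ → ℝ) p :=
    (measurable_one.indicator hAm).const_mul θ
  have hi0 : ∀ p, 0 ≤ A.indicator (1 : ℝ × ℝ → ℝ) p :=
    fun p => Set.indicator_nonneg (fun _ _ => zero_le_one) p
  have hi1 : ∀ p, A.indicator (1 : ℝ × ℝ → ℝ) p ≤ 1 :=
    fun p => Set.indicator_le_self' (fun _ _ => zero_le_one) p
  have hb2 : ∀ p, |θ * A.indicator (1 : ℝ × ℝ → ℝ) p| ≤ 1 := fun p => by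
    rw [abs_of_nonneg (mul_nonneg h0 (hi0 p))]; nlinarith [hi0 p, hi1 p]
  obtain ⟨i1, e1⟩ := lintegral_exp_eq_ofReal_integral (μ := μ) hfm hb2
  have key := h.lintegral_exp hfm hfm (integral_nonneg fun _ => (Real.exp_pos _).le)
    (integral_nonneg fun _ => (Real.exp_pos _).le) e1 e1
  have hs : ∀ ω, θ * (dotSum (blue ω) (A.indicator 1) + dotSum (red ω) (A.indicator 1)) =
      dotSum (blue ω) (fun p => θ * A.indicator 1 p) +
        dotSum (red ω) (fun p => θ * A.indicator 1 p) := by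
    intro ω
    simp only [dotSum, ← Finset.mul_sum]
    ring
  simp only [hs]
  rw [key]
  refine ENNReal.ofReal_le_ofReal (Real.exp_le_exp.2 ?_)
  rw [← cond_grid_real hm hA]
  -- Both colours have the same sign here, so nothing cancels and the exponent is linear in `θ`.
  have h2 : ∫ p, Real.exp (θ * A.indicator 1 p) ∂μ ≤ ∫ p, (1 + 2 * θ * A.indicator 1 p) ∂μ := by
    refine integral_mono i1 (integrable_add_mul_indicator hAm _ _) fun p => ?_
    refine (exp_le_one_add_two_mul (mul_nonneg h0 (hi0 p)) (le_of_abs_le (hb2 p))).trans ?_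
    simp only [mul_assoc, le_refl]
  rw [integral_add_mul_indicator hAm] at h2
  nlinarith [mul_le_mul_of_nonneg_left h2 (sq_nonneg m)]

/-- Chernoff bound from a bound on the exponential moment. -/
theorem measureReal_le_exp_of_lintegral_exp_le [IsProbabilityMeasure P] {X : Ω → ℝ}
    (hX : AEMeasurable X P) {a s : ℝ}
    (h : ∫⁻ ω, ENNReal.ofReal (Real.exp (X ω)) ∂P ≤ ENNReal.ofReal (Real.exp a)) :
    P.real {ω | a + s ≤ X ω} ≤ Real.exp (-s) := by
  have h1 := mul_meas_ge_le_lintegral₀ (μ := P)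
    (f := fun ω => ENNReal.ofReal (Real.exp (X ω))) (by fun_prop)
    (ENNReal.ofReal (Real.exp (a + s)))
  have h2 : {ω | ENNReal.ofReal (Real.exp (a + s)) ≤ ENNReal.ofReal (Real.exp (X ω))} =
      {ω | a + s ≤ X ω} := by
    ext ω
    simp [ENNReal.ofReal_le_ofReal_iff (Real.exp_pos _).le]
  rw [h2] at h1
  have h3 := ENNReal.toReal_mono ENNReal.ofReal_ne_top (h1.trans h)
  rw [ENNReal.toReal_mul, ENNReal.toReal_ofReal (Real.exp_pos _).le,
    ENNReal.toReal_ofReal (Real.exp_pos _).le, ← measureReal_def, Real.exp_add] at h3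
  have h4 : Real.exp (-s) = Real.exp a * Real.exp (-s) / Real.exp a := by
    field_simp
  rw [Real.exp_neg, ← one_div, le_div_iff₀ (Real.exp_pos _)]
  have := Real.exp_pos a
  nlinarith

end

section

/-! ### Monotone paths as Lipschitz functions in rotated coordinates -/

/-- The points below the graph of `h` in the coordinates `x + y` and `(y - x) / 2`. -/
def below (h : ℝ → ℝ) : Set (ℝ × ℝ) := {p | (p.2 - p.1) / 2 < h (p.1 + p.2)}

theorem measurableSet_below {h : ℝ → ℝ} (hh : Measurable h) : MeasurableSet (below h) :=
  measurableSet_lt (by fun_prop) (by fun_prop)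

variable {m : ℝ}

/-- The antidiagonal through a point of the square meets the path, and by monotonicity comparing
along the antidiagonal decides the same question as comparing along the vertical, even when the path
has vertical segments. -/
theorem beneath_eq_of_graph (γ : Path ((0, 0) : ℝ × ℝ) (m, m)) (hγ : IsMonotonePath γ) {h : ℝ → ℝ}
    (hh : ∀ t, h ((γ t).1 + (γ t).2) = ((γ t).2 - (γ t).1) / 2) :
    beneath γ = grid m ∩ below h := by
  have hc1 : Continuous fun t => (γ t).1 := by fun_prop
  have hc : Continuous fun t => (γ t).1 + (γ t).2 := by fun_prop
  ext p
  refine and_congr_right fun hp => ?_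
  obtain ⟨⟨hx0, hxm⟩, hy0, hym⟩ := hp
  obtain ⟨t, ht⟩ : ∃ t, (γ t).1 + (γ t).2 = p.1 + p.2 := by
    refine intermediate_value_univ 0 1 hc ?_
    simp only [γ.source, γ.target]
    constructor <;> linarith
  obtain ⟨s, hs⟩ : ∃ s, (γ s).1 = p.1 := by
    refine intermediate_value_univ 0 1 hc1 ?_
    simp only [γ.source, γ.target]
    constructor <;> linarith
  have hb : p ∈ below h ↔ (γ t).1 < p.1 := by
    change (p.2 - p.1) / 2 < h (p.1 + p.2) ↔ _
    rw [← ht, hh t]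
    constructor <;> intro <;> linarith
  rw [hb]
  constructor
  · intro H
    by_contra! hlt
    rcases le_total s t with hst | hst
    · have := (hγ hst).2
      linarith [H s hs]
    · have h1 := (hγ hst).1
      have h2 : (γ t).1 = p.1 := by linarith
      linarith [H t h2]
  · intro H r hr
    rcases le_total r t with hrt | hrt
    · have := (hγ hrt).1
      linarith
    · have := (hγ hrt).2
      linarith

/-- The functions that describe monotone paths in rotated coordinates. -/
structure IsProfile (m : ℝ) (h : ℝ → ℝ) : Prop where
  lipschitz : ∀ u v, |h u - h v| ≤ |u - v| / 2
  left : h 0 = 0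
  right : h (2 * m) = 0

theorem IsProfile.continuous {h : ℝ → ℝ} (hh : IsProfile m h) : Continuous h := by
  refine (LipschitzWith.of_dist_le_mul (K := 1) fun u v => ?_).continuous
  rw [Real.dist_eq, Real.dist_eq, NNReal.coe_one, one_mul]
  linarith [hh.lipschitz u v, abs_nonneg (u - v)]

theorem exists_profile_of_path (hm : 0 ≤ m) (γ : Path ((0, 0) : ℝ × ℝ) (m, m))
    (hγ : IsMonotonePath γ) : ∃ h, IsProfile m h ∧ beneath γ = grid m ∩ below h := by
  have hc : Continuous fun t => (γ t).1 + (γ t).2 := by fun_prop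
  have hlip : ∀ s t, |((γ s).2 - (γ s).1) / 2 - ((γ t).2 - (γ t).1) / 2| ≤
      |((γ s).1 + (γ s).2) - ((γ t).1 + (γ t).2)| / 2 := by
    have aux : ∀ s t, s ≤ t → |((γ s).2 - (γ s).1) / 2 - ((γ t).2 - (γ t).1) / 2| ≤
        |((γ s).1 + (γ s).2) - ((γ t).1 + (γ t).2)| / 2 := by
      intro s t hst
      have h1 := (hγ hst).1
      have h2 := (hγ hst).2
      rw [abs_of_nonpos (a := (γ s).1 + (γ s).2 - ((γ t).1 + (γ t).2)) (by linarith), abs_le]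
      constructor <;> linarith
    intro s t
    rcases le_total s t with hst | hst
    · exact aux s t hst
    · rw [abs_sub_comm, abs_sub_comm ((γ s).1 + (γ s).2)]
      exact aux t s hst
  have hm2 : (0 : ℝ) ≤ 2 * m := by linarith
  have hex : ∀ u : ℝ, ∃ t, (γ t).1 + (γ t).2 = Set.projIcc 0 (2 * m) hm2 u := by
    intro u
    refine intermediate_value_univ 0 1 hc ?_
    have := (Set.projIcc 0 (2 * m) hm2 u).2
    simp only [γ.source, γ.target]
    constructor <;> linarith [this.1, this.2]
  choose τ hτ using hex
  -- The Lipschitz estimate makes the value independent of the choice of `τ`, also where the path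
  -- rests.
  have hval : ∀ u t, (γ t).1 + (γ t).2 = Set.projIcc 0 (2 * m) hm2 u →
      ((γ (τ u)).2 - (γ (τ u)).1) / 2 = ((γ t).2 - (γ t).1) / 2 := by
    intro u t ht
    have := hlip (τ u) t
    rw [hτ, ht, sub_self, abs_zero, zero_div] at this
    exact sub_eq_zero.1 (abs_eq_zero.1 (le_antisymm this (abs_nonneg _)))
  refine ⟨fun u => ((γ (τ u)).2 - (γ (τ u)).1) / 2, ⟨fun u v => ?_, ?_, ?_⟩, ?_⟩
  · refine (hlip _ _).trans ?_
    rw [hτ, hτ]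
    have := Set.abs_projIcc_sub_projIcc (c := u) (d := v) hm2
    linarith
  · refine (hval 0 0 ?_).trans (by simp [γ.source])
    rw [Set.projIcc_of_le_left hm2 le_rfl]
    simp [γ.source]
  · refine (hval (2 * m) 1 ?_).trans (by simp [γ.target])
    rw [Set.projIcc_of_right_le hm2 le_rfl]
    simp only [γ.target]
    ring
  · refine beneath_eq_of_graph γ hγ fun t => hval _ t ?_
    have hmem : (γ t).1 + (γ t).2 ∈ Set.Icc 0 (2 * m) := by
      have h0 := hγ (show (0 : unitInterval) ≤ t from t.2.1)
      have h1 := hγ (show t ≤ (1 : unitInterval) from t.2.2)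
      rw [γ.source] at h0
      rw [γ.target] at h1
      obtain ⟨a, b⟩ := h0
      obtain ⟨c, d⟩ := h1
      simp only at a b c d
      constructor <;> linarith
    rw [Set.projIcc_of_mem hm2 hmem]

theorem exists_path_of_profile (hm : 0 ≤ m) {h : ℝ → ℝ} (hh : IsProfile m h) :
    ∃ γ : Path ((0, 0) : ℝ × ℝ) (m, m), IsMonotonePath γ ∧ beneath γ = grid m ∩ below h := by
  have hcont := hh.continuous
  let γ : Path ((0, 0) : ℝ × ℝ) (m, m) :=
    { toFun := fun t => ((t : ℝ) * m - h (2 * m * t), (t : ℝ) * m + h (2 * m * t))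
      continuous_toFun := by fun_prop
      source' := by simp [hh.left]
      target' := by simp [hh.right] }
  have hγ : IsMonotonePath γ := by
    intro s t hst
    have hst' : (s : ℝ) ≤ t := hst
    have h1 := hh.lipschitz (2 * m * t) (2 * m * s)
    rw [show 2 * m * (t : ℝ) - 2 * m * s = 2 * (m * (t - s)) by ring,
      abs_of_nonneg (a := 2 * (m * ((t : ℝ) - s)))
        (mul_nonneg zero_le_two (mul_nonneg hm (by linarith)))] at h1
    have h2 := abs_le.1 h1
    exact ⟨by change (s : ℝ) * m - h (2 * m * s) ≤ t * m - h (2 * m * t); nlinarith,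
      by change (s : ℝ) * m + h (2 * m * s) ≤ t * m + h (2 * m * t); nlinarith⟩
  refine ⟨γ, hγ, beneath_eq_of_graph γ hγ fun t => ?_⟩
  change h ((t : ℝ) * m - h (2 * m * t) + (t * m + h (2 * m * t))) =
    ((t : ℝ) * m + h (2 * m * t) - (t * m - h (2 * m * t))) / 2
  ring_nf

/-- The surplus of the part of the grid below a graph. -/
def profileSurplus (m : ℝ) (blue red : Dots) (h : ℝ → ℝ) : ℤ :=
  (dotCount blue (grid m ∩ below h) : ℤ) - dotCount red (grid m ∩ below h)

theorem profileSurplus_le_maxSurplus (hm : 0 ≤ m) (blue red : Dots) {h : ℝ → ℝ}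
    (hh : IsProfile m h) : profileSurplus m blue red h ≤ maxSurplus m blue red := by
  obtain ⟨γ, hγ, he⟩ := exists_path_of_profile hm hh
  exact (isGreatest_maxSurplus hm blue red).2 ⟨γ, hγ, by rw [surplus, he, profileSurplus]⟩

theorem exists_profile_eq_maxSurplus (hm : 0 ≤ m) (blue red : Dots) :
    ∃ h, IsProfile m h ∧ maxSurplus m blue red = profileSurplus m blue red h := by
  obtain ⟨γ, hγ, he⟩ := (isGreatest_maxSurplus hm blue red).1
  obtain ⟨h, hh, hb⟩ := exists_profile_of_path hm γ hγ
  exact ⟨h, hh, by rw [← he, surplus, hb, profileSurplus]⟩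

end

section

/-! ### Measurability of the maximum surplus -/

variable {m : ℝ}

theorem mem_below {h : ℝ → ℝ} {p : ℝ × ℝ} :
    p ∈ below h ↔ (p.2 - p.1) / 2 < h (p.1 + p.2) := Iff.rfl

theorem dotCount_congr {D : Dots} {A B : Set (ℝ × ℝ)}
    (h : ∀ i < D.1, (D.2 i ∈ A ↔ D.2 i ∈ B)) : dotCount D A = dotCount D B := by
  unfold dotCount
  congr 1
  ext i
  exact and_congr_right (h i)

theorem cast_profileSurplus (blue red : Dots) (h : ℝ → ℝ) :
    (profileSurplus m blue red h : ℝ) = dotSum blue ((grid m ∩ below h).indicator 1) -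
      dotSum red ((grid m ∩ below h).indicator 1) := by
  rw [dotSum_indicator, dotSum_indicator, profileSurplus]
  push_cast
  rfl

theorem measurable_profileSurplus {h : ℝ → ℝ} (hh : Measurable h) :
    Measurable fun D : Dots × Dots => (profileSurplus m D.1 D.2 h : ℝ) := by
  simp only [cast_profileSurplus]
  have hi : Measurable ((grid m ∩ below h).indicator (1 : ℝ × ℝ → ℝ)) :=
    measurable_one.indicator (measurableSet_grid.inter (measurableSet_below hh))
  exact ((measurable_dotSum hi).comp measurable_fst).sub ((measurable_dotSum hi).comp measurable_snd)

/-- A profile shifted down, then raised to the lower boundary of the grid. -/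
def shiftDown (m : ℝ) (h : ℝ → ℝ) (ε : ℝ) (u : ℝ) : ℝ := max (h u - ε) (|u - m| / 2 - m / 2)

theorem IsProfile.shiftDown {h : ℝ → ℝ} (hh : IsProfile m h) (hm : 0 ≤ m) {ε : ℝ} (hε : 0 ≤ ε) :
    IsProfile m (shiftDown m h ε) := by
  refine ⟨fun u v => ?_, ?_, ?_⟩
  · refine (abs_max_sub_max_le_max _ _ _ _).trans (max_le ?_ ?_)
    · rw [sub_sub_sub_cancel_right]
      exact hh.lipschitz u v
    · have h1 := abs_abs_sub_abs_le (u - m) (v - m)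
      rw [sub_sub_sub_cancel_right] at h1
      rw [sub_sub_sub_cancel_right, ← sub_div, abs_div, abs_two]
      linarith
  · rw [PathSurplus.shiftDown, hh.left, zero_sub, zero_sub, abs_neg, abs_of_nonneg hm, sub_self,
      max_eq_right (by linarith)]
  · rw [PathSurplus.shiftDown, hh.right, show 2 * m - m = m by ring, abs_of_nonneg hm, sub_self,
      max_eq_right (by linarith)]

/-- No point of the square lies below its lower boundary, so the raising that restores the endpoint
values changes no count. -/
theorem grid_inter_below_shiftDown (h : ℝ → ℝ) (ε : ℝ) :
    grid m ∩ below (shiftDown m h ε) = grid m ∩ below fun u => h u - ε := by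
  ext p
  refine and_congr_right fun hp => ?_
  obtain ⟨⟨hx0, hxm⟩, hy0, hym⟩ := hp
  have hb : |p.1 + p.2 - m| / 2 - m / 2 ≤ (p.2 - p.1) / 2 := by
    have : |p.1 + p.2 - m| ≤ m + p.2 - p.1 := abs_le.2 ⟨by linarith, by linarith⟩
    linarith
  rw [mem_below, mem_below, shiftDown, lt_max_iff]
  exact ⟨fun H => H.resolve_right (not_lt.2 hb), Or.inl⟩

theorem profileSurplus_sub_le_maxSurplus (hm : 0 ≤ m) (blue red : Dots) {h : ℝ → ℝ}
    (hh : IsProfile m h) {ε : ℝ} (hε : 0 ≤ ε) :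
    profileSurplus m blue red (fun u => h u - ε) ≤ maxSurplus m blue red := by
  have := profileSurplus_le_maxSurplus hm blue red (hh.shiftDown hm hε)
  rwa [profileSurplus, grid_inter_below_shiftDown] at this

theorem maxSurplus_nonneg (hm : 0 ≤ m) (blue red : Dots) : 0 ≤ maxSurplus m blue red := by
  have h0 : IsProfile m fun _ => 0 := ⟨fun u v => by simp only [sub_self, abs_zero]; positivity,
    rfl, rfl⟩
  refine le_trans ?_ (profileSurplus_sub_le_maxSurplus hm blue red h0 hm)
  have he : grid m ∩ below (fun _ => 0 - m) = ∅ := by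
    refine Set.eq_empty_of_forall_notMem fun p ⟨⟨⟨hx0, hxm⟩, hy0, hym⟩, hb⟩ => ?_
    change (p.2 - p.1) / 2 < 0 - m at hb
    linarith
  rw [profileSurplus, he]
  simp [dotCount]

/-- Countably many profiles approximate all profiles uniformly. -/
theorem exists_dense_profiles (m : ℝ) : ∃ d : ℕ → ℝ → ℝ, (∀ i, IsProfile m (d i)) ∧
    ∀ h, IsProfile m h → ∀ ε > 0, ∃ i, ∀ u ∈ Set.Icc 0 (2 * m), |h u - d i u| < ε := by
  let S : Set C(Set.Icc 0 (2 * m), ℝ) := {f | ∃ h, IsProfile m h ∧ ∀ u, f u = h u}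
  have hz : (0 : C(Set.Icc 0 (2 * m), ℝ)) ∈ S :=
    ⟨fun _ => 0, ⟨fun u v => by simp only [sub_self, abs_zero]; positivity, rfl, rfl⟩,
      fun _ => rfl⟩
  have : Nonempty S := ⟨⟨0, hz⟩⟩
  obtain ⟨d, hd⟩ := TopologicalSpace.exists_dense_seq S
  choose h hh hf using fun i => (d i).2
  refine ⟨h, hh, fun g hg ε hε => ?_⟩
  let f : C(Set.Icc 0 (2 * m), ℝ) := ⟨fun u => g u, hg.continuous.comp continuous_subtype_val⟩
  obtain ⟨i, hi⟩ := hd.exists_dist_lt (⟨f, g, hg, fun _ => rfl⟩ : S) hε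
  refine ⟨i, fun u hu => ?_⟩
  have h1 := (ContinuousMap.dist_lt_iff hε).1 hi ⟨u, hu⟩
  rwa [hf i, Real.dist_eq] at h1

theorem add_mem_Icc_of_mem_grid {p : ℝ × ℝ} (hp : p ∈ grid m) :
    p.1 + p.2 ∈ Set.Icc 0 (2 * m) := by
  obtain ⟨⟨hx0, hxm⟩, hy0, hym⟩ := hp
  constructor <;> linarith

/-- The dots are finitely many and those beneath an optimal profile lie strictly beneath it, so a
small downward shift of a good approximation separates them in the same way. The maximum is
therefore reached within a countable family, which yields measurability. -/
theorem exists_dense_profile_eq_maxSurplus (hm : 0 ≤ m) {d : ℕ → ℝ → ℝ}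
    (hd : ∀ h, IsProfile m h → ∀ ε > 0, ∃ i, ∀ u ∈ Set.Icc 0 (2 * m), |h u - d i u| < ε)
    (blue red : Dots) :
    ∃ i n : ℕ, maxSurplus m blue red =
      profileSurplus m blue red fun u => d i u - 1 / ((n : ℝ) + 1) := by
  obtain ⟨h, hh, he⟩ := exists_profile_eq_maxSurplus hm blue red
  -- The margin is twice 1/(n+1): once for the approximation error and once for the shift.
  have hev : ∀ p : ℝ × ℝ, ∀ᶠ n : ℕ in Filter.atTop,
      p ∈ below h → (p.2 - p.1) / 2 < h (p.1 + p.2) - 2 * (1 / ((n : ℝ) + 1)) := by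
    intro p
    by_cases hp : p ∈ below h
    · have ht : Filter.Tendsto (fun n : ℕ => h (p.1 + p.2) - 2 * (1 / ((n : ℝ) + 1)))
          Filter.atTop (nhds (h (p.1 + p.2) - 2 * 0)) :=
        (tendsto_one_div_add_atTop_nhds_zero_nat.const_mul 2).const_sub _
      rw [mul_zero, sub_zero] at ht
      exact (ht.eventually (lt_mem_nhds hp)).mono fun n hn _ => hn
    · exact Filter.Eventually.of_forall fun n hp' => absurd hp' hp
  have hall : ∀ D : Dots, ∀ᶠ n : ℕ in Filter.atTop, ∀ i ∈ Finset.range D.1,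
      D.2 i ∈ below h → ((D.2 i).2 - (D.2 i).1) / 2 <
        h ((D.2 i).1 + (D.2 i).2) - 2 * (1 / ((n : ℝ) + 1)) :=
    fun D => (Filter.eventually_all_finset _).2 fun i _ => hev (D.2 i)
  obtain ⟨n, hb, hr⟩ := ((hall blue).and (hall red)).exists
  have hn : (0 : ℝ) < 1 / ((n : ℝ) + 1) := by positivity
  obtain ⟨i, hi⟩ := hd h hh _ hn
  have key : ∀ D : Dots, (∀ i ∈ Finset.range D.1, D.2 i ∈ below h →
      ((D.2 i).2 - (D.2 i).1) / 2 < h ((D.2 i).1 + (D.2 i).2) - 2 * (1 / ((n : ℝ) + 1))) →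
      dotCount D (grid m ∩ below h) =
        dotCount D (grid m ∩ below fun u => d i u - 1 / ((n : ℝ) + 1)) := by
    intro D hD
    refine dotCount_congr fun j hj => and_congr_right fun hp => ?_
    have h1 := abs_lt.1 (hi _ (add_mem_Icc_of_mem_grid hp))
    refine ⟨fun h2 => ?_, fun h2 => ?_⟩
    · have h3 := hD j (Finset.mem_range.2 hj) h2
      rw [mem_below]
      linarith
    · rw [mem_below] at h2 ⊢
      linarith
  exact ⟨i, n, by rw [he, profileSurplus, profileSurplus, key blue hb, key red hr]⟩

theorem measurable_maxSurplus (hm : 0 ≤ m) :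
    Measurable fun D : Dots × Dots => (maxSurplus m D.1 D.2 : ℝ) := by
  obtain ⟨d, hd, hdense⟩ := exists_dense_profiles m
  refine measurable_of_Ici fun x => ?_
  have h : (fun D : Dots × Dots => (maxSurplus m D.1 D.2 : ℝ)) ⁻¹' Set.Ici x =
      ⋃ i : ℕ, ⋃ n : ℕ, {D : Dots × Dots |
        x ≤ (profileSurplus m D.1 D.2 (fun u => d i u - 1 / ((n : ℝ) + 1)) : ℝ)} := by
    ext D
    simp only [Set.mem_preimage, Set.mem_Ici, Set.mem_iUnion, Set.mem_ofPred_eq]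
    constructor
    · intro hx
      obtain ⟨i, n, he⟩ := exists_dense_profile_eq_maxSurplus hm hdense D.1 D.2
      exact ⟨i, n, he ▸ hx⟩
    · rintro ⟨i, n, hx⟩
      exact hx.trans (Int.cast_le.2 (profileSurplus_sub_le_maxSurplus hm D.1 D.2 (hd i)
        (by positivity)))
  rw [h]
  refine MeasurableSet.iUnion fun i => MeasurableSet.iUnion fun n => ?_
  exact measurableSet_le measurable_const
    (measurable_profileSurplus ((hd i).continuous.measurable.sub_const _))

end

section

/-! ### Dyadic piecewise linear approximation -/

/-- The piecewise linear interpolation of a sequence. -/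
def lin (q : ℕ → ℝ) (x : ℝ) : ℝ :=
  (1 - (x - ⌊x⌋₊)) * q ⌊x⌋₊ + (x - ⌊x⌋₊) * q (⌊x⌋₊ + 1)

theorem lin_eq_of_mem {q : ℕ → ℝ} {x : ℝ} {j : ℕ} (h0 : (j : ℝ) ≤ x) (h1 : x < j + 1) :
    lin q x = (1 - (x - j)) * q j + (x - j) * q (j + 1) := by
  have : ⌊x⌋₊ = j := (Nat.floor_eq_iff ((Nat.cast_nonneg j).trans h0)).2 ⟨h0, h1⟩
  rw [lin, this]

theorem measurable_lin (q : ℕ → ℝ) : Measurable (lin q) := by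
  have hf : Measurable fun x : ℝ => ⌊x⌋₊ := Nat.measurable_floor
  have h1 : Measurable fun x : ℝ => ((⌊x⌋₊ : ℕ) : ℝ) :=
    (measurable_from_top (f := fun n : ℕ => (n : ℝ))).comp hf
  have h2 : Measurable fun x : ℝ => q ⌊x⌋₊ := (measurable_from_top (f := q)).comp hf
  have h3 : Measurable fun x : ℝ => q (⌊x⌋₊ + 1) :=
    (measurable_from_top (f := fun n => q (n + 1))).comp hf
  unfold lin
  fun_prop

theorem lin_add (p q : ℕ → ℝ) (x : ℝ) : lin (fun i => p i + q i) x = lin p x + lin q x := by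
  simp only [lin]; ring

theorem abs_lin_le {q : ℕ → ℝ} {x : ℝ} (hx : 0 ≤ x) :
    |lin q x| ≤ |q ⌊x⌋₊| + |q (⌊x⌋₊ + 1)| := by
  have h0 : 0 ≤ x - ⌊x⌋₊ := sub_nonneg.2 (Nat.floor_le hx)
  have h1 : x - ⌊x⌋₊ ≤ 1 := by linarith [Nat.lt_floor_add_one x]
  refine (abs_add_le _ _).trans ?_
  rw [abs_mul, abs_mul, abs_of_nonneg h0, abs_of_nonneg (sub_nonneg.2 h1)]
  nlinarith [abs_nonneg (q ⌊x⌋₊), abs_nonneg (q (⌊x⌋₊ + 1))]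

theorem abs_sub_lin_le {q : ℕ → ℝ} {x y r : ℝ} (hx : 0 ≤ x)
    (h0 : |y - q ⌊x⌋₊| ≤ r) (h1 : |y - q (⌊x⌋₊ + 1)| ≤ r) : |y - lin q x| ≤ r := by
  have a0 : 0 ≤ x - ⌊x⌋₊ := sub_nonneg.2 (Nat.floor_le hx)
  have a1 : 0 ≤ 1 - (x - ⌊x⌋₊) := by linarith [Nat.lt_floor_add_one x]
  have he : y - lin q x = (1 - (x - ⌊x⌋₊)) * (y - q ⌊x⌋₊) +
      (x - ⌊x⌋₊) * (y - q (⌊x⌋₊ + 1)) := by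
    simp only [lin]; ring
  rw [he]
  refine (abs_add_le _ _).trans ?_
  rw [abs_mul, abs_mul, abs_of_nonneg a0, abs_of_nonneg a1]
  nlinarith [mul_le_mul_of_nonneg_left h0 a1, mul_le_mul_of_nonneg_left h1 a0]

/-- Inserting midpoints does not change an interpolant. The factor 2 appears because the unit of the
node values is halved with the mesh; i/2 and (i+1)/2 are equal for even i and the two neighbours for
odd i. -/
theorem lin_two_mul (q : ℕ → ℝ) {x : ℝ} (hx : 0 ≤ x) :
    lin (fun i => q (i / 2) + q ((i + 1) / 2)) (2 * x) = 2 * lin q x := by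
  have h0 := Nat.floor_le hx
  have h1 := Nat.lt_floor_add_one x
  rw [lin_eq_of_mem (q := q) h0 h1]
  set j := ⌊x⌋₊
  rcases lt_or_ge (x - j) (1 / 2) with h | h
  · rw [lin_eq_of_mem (j := 2 * j) (by push_cast; linarith) (by push_cast; linarith),
      show 2 * j / 2 = j by omega, show (2 * j + 1) / 2 = j by omega,
      show (2 * j + 1 + 1) / 2 = j + 1 by omega]
    push_cast
    ring
  · rw [lin_eq_of_mem (j := 2 * j + 1) (by push_cast; linarith) (by push_cast; linarith),
      show (2 * j + 1) / 2 = j by omega, show (2 * j + 1 + 1) / 2 = j + 1 by omega,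
      show (2 * j + 1 + 1 + 1) / 2 = j + 1 by omega]
    push_cast
    ring

/-- The node values that are decoded from a family of dyadic corrections. -/
def dec (e : ℕ → ℕ → ℤ) : ℕ → ℕ → ℤ
  | 0, _ => 0
  | k + 1, i => dec e k (i / 2) + dec e k ((i + 1) / 2) + e k i

theorem dec_congr {e e' : ℕ → ℕ → ℤ} {k : ℕ} (h : ∀ i < k, ∀ j, e i j = e' i j) (j : ℕ) :
    dec e k j = dec e' k j := by
  induction k generalizing j with
  | zero => rfl
  | succ k ih =>
    have ih' := fun j => ih (fun i hi => h i (by omega)) j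
    simp only [dec, ih', h k (by omega)]

/-- The mesh width at level `k`. -/
def width (m : ℝ) (k : ℕ) : ℝ := 2 * m / 2 ^ k

theorem width_succ (m : ℝ) (k : ℕ) : width m k = 2 * width m (k + 1) := by
  simp only [width, pow_succ]; field_simp

theorem width_pos {m : ℝ} (hm : 0 < m) (k : ℕ) : 0 < width m k := by
  unfold width; positivity

/-- The piecewise linear function at level `k` that is decoded from a family of corrections. -/
def approx (m δ : ℝ) (e : ℕ → ℕ → ℤ) (k : ℕ) (u : ℝ) : ℝ :=
  δ * width m k * lin (fun j => (dec e k j : ℝ)) (u / width m k)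

theorem measurable_approx (m δ : ℝ) (e : ℕ → ℕ → ℤ) (k : ℕ) : Measurable (approx m δ e k) :=
  ((measurable_lin _).comp (measurable_id.div_const _)).const_mul _

theorem approx_congr {m δ : ℝ} {e e' : ℕ → ℕ → ℤ} {k : ℕ} (h : ∀ i < k, ∀ j, e i j = e' i j) :
    approx m δ e k = approx m δ e' k := by
  funext u
  simp only [approx, dec_congr h]

theorem approx_zero (m δ : ℝ) (e : ℕ → ℕ → ℤ) (u : ℝ) : approx m δ e 0 u = 0 := by
  simp [approx, dec, lin]

theorem approx_succ {m : ℝ} (hm : 0 < m) (δ : ℝ) (e : ℕ → ℕ → ℤ) (k : ℕ) {u : ℝ} (hu : 0 ≤ u) :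
    approx m δ e (k + 1) u = approx m δ e k u +
      δ * width m (k + 1) * lin (fun j => (e k j : ℝ)) (u / width m (k + 1)) := by
  have hw := width_pos hm (k + 1)
  have h1 : u / width m (k + 1) = 2 * (u / width m k) := by
    rw [width_succ m k]; field_simp
  simp only [approx]
  have h2 : lin (fun j => (dec e (k + 1) j : ℝ)) (u / width m (k + 1)) =
      2 * lin (fun j => (dec e k j : ℝ)) (u / width m k) +
        lin (fun j => (e k j : ℝ)) (u / width m (k + 1)) := by
    rw [← lin_two_mul _ (div_nonneg hu (width_pos hm k).le), ← h1, ← lin_add]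
    congr 1
    funext j
    simp only [dec]
    push_cast
    rfl
  rw [h2, width_succ m k]
  ring

/-! ### Area of a thin neighbourhood of a graph -/

/-- The shear (x, y) ↦ (x + y, y) preserves area and turns (y - x)/2 into y - u/2, so each section
is contained in an interval of length 2r. -/
theorem volume_strip_le {c : ℝ → ℝ} (hc : Measurable c) {a b r : ℝ} (hab : a ≤ b) :
    volume {p : ℝ × ℝ | p.1 + p.2 ∈ Set.Icc a b ∧ |(p.2 - p.1) / 2 - c (p.1 + p.2)| ≤ r} ≤
      ENNReal.ofReal ((b - a) * (2 * r)) := by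
  let T : Set (ℝ × ℝ) := {z | z.1 ∈ Set.Icc a b ∧ |z.2 - z.1 / 2 - c z.1| ≤ r}
  have hT : MeasurableSet T :=
    (measurable_fst measurableSet_Icc).inter
      (measurableSet_le (f := fun z : ℝ × ℝ => |z.2 - z.1 / 2 - c z.1|) (by fun_prop)
        measurable_const)
  have hpre : {p : ℝ × ℝ | p.1 + p.2 ∈ Set.Icc a b ∧ |(p.2 - p.1) / 2 - c (p.1 + p.2)| ≤ r} =
      (fun z : ℝ × ℝ => (z.1 + z.2, z.2)) ⁻¹' T := by
    ext p
    have : (p.2 - p.1) / 2 - c (p.1 + p.2) = p.2 - (p.1 + p.2) / 2 - c (p.1 + p.2) := by ring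
    change _ ∧ |(p.2 - p.1) / 2 - c (p.1 + p.2)| ≤ r ↔
      p.1 + p.2 ∈ Set.Icc a b ∧ |p.2 - (p.1 + p.2) / 2 - c (p.1 + p.2)| ≤ r
    rw [this]
  rw [hpre, Measure.volume_eq_prod,
    (measurePreserving_add_prod volume volume).measure_preimage hT.nullMeasurableSet,
    Measure.prod_apply hT]
  have hle : ∀ x, volume (Prod.mk x ⁻¹' T) ≤
      (Set.Icc a b).indicator (fun _ => ENNReal.ofReal (2 * r)) x := by
    intro x
    by_cases hx : x ∈ Set.Icc a b
    · rw [Set.indicator_of_mem hx]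
      have hs : Prod.mk x ⁻¹' T ⊆ Set.Icc (x / 2 + c x - r) (x / 2 + c x + r) := by
        intro y hy
        have h2 := abs_le.1 (show |y - x / 2 - c x| ≤ r from hy.2)
        constructor <;> linarith
      refine (measure_mono hs).trans ?_
      rw [Real.volume_Icc]
      exact ENNReal.ofReal_le_ofReal (by linarith)
    · have hs : Prod.mk x ⁻¹' T = ∅ := Set.eq_empty_of_forall_notMem fun y hy => hx hy.1
      rw [hs, measure_empty]
      exact zero_le
  refine (lintegral_mono hle).trans ?_
  rw [lintegral_indicator_const measurableSet_Icc, Real.volume_Icc,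
    ENNReal.ofReal_mul (sub_nonneg.2 hab), mul_comm]

theorem volume_real_le_sum_strips {A : Set (ℝ × ℝ)} {c : ℝ → ℝ} (hc : Measurable c) {w : ℝ}
    (hw : 0 < w) {r : ℕ → ℝ} (hr : ∀ j, 0 ≤ r j) {N : ℕ} (hA : ∀ p ∈ A, 0 ≤ p.1 + p.2 ∧
      ⌊(p.1 + p.2) / w⌋₊ < N ∧ |(p.2 - p.1) / 2 - c (p.1 + p.2)| ≤ r ⌊(p.1 + p.2) / w⌋₊) :
    volume.real A ≤ ∑ j ∈ Finset.range N, w * (2 * r j) := by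
  have hsub : A ⊆ ⋃ j ∈ Finset.range N, {p : ℝ × ℝ | p.1 + p.2 ∈ Set.Icc (j * w) ((j + 1) * w) ∧
      |(p.2 - p.1) / 2 - c (p.1 + p.2)| ≤ r j} := by
    intro p hp
    obtain ⟨h0, h1, h2⟩ := hA p hp
    simp only [Set.mem_iUnion]
    refine ⟨_, Finset.mem_range.2 h1, ⟨?_, ?_⟩, h2⟩
    · exact (le_div_iff₀ hw).1 (Nat.floor_le (div_nonneg h0 hw.le))
    · exact (div_le_iff₀ hw).1 (Nat.lt_floor_add_one _).le
  have hle : volume A ≤ ENNReal.ofReal (∑ j ∈ Finset.range N, w * (2 * r j)) := by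
    refine (measure_mono hsub).trans ((measure_biUnion_finset_le _ _).trans ?_)
    rw [ENNReal.ofReal_sum_of_nonneg fun j _ => mul_nonneg hw.le
      (mul_nonneg zero_le_two (hr j))]
    refine Finset.sum_le_sum fun j _ => ?_
    refine (volume_strip_le hc (by nlinarith)).trans (le_of_eq ?_)
    congr 1
    ring
  exact ENNReal.toReal_le_of_le_ofReal (Finset.sum_nonneg fun j _ => mul_nonneg hw.le
      (mul_nonneg zero_le_two (hr j))) hle

/-- The extra 1 is for the corner (m, m), where the floor equals 2^k. -/
theorem floor_div_width_lt {m : ℝ} (hm : 0 < m) (k : ℕ) {p : ℝ × ℝ} (hp : p ∈ grid m) :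
    ⌊(p.1 + p.2) / width m k⌋₊ < 2 ^ k + 1 := by
  have h1 := (add_mem_Icc_of_mem_grid hp)
  have h2 : (p.1 + p.2) / width m k ≤ ((2 ^ k : ℕ) : ℝ) := by
    rw [div_le_iff₀ (width_pos hm k), width]
    push_cast
    rw [mul_div_cancel₀ _ (by positivity)]
    exact h1.2
  have h3 := Nat.floor_le_floor h2
  rw [Nat.floor_natCast] at h3
  omega

/-- The region of the grid between consecutive approximations. -/
def stepRegion (m δ : ℝ) (e : ℕ → ℕ → ℤ) (k : ℕ) : Set (ℝ × ℝ) :=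
  ((grid m ∩ below (approx m δ e (k + 1))) \ below (approx m δ e k)) ∪
    ((grid m ∩ below (approx m δ e k)) \ below (approx m δ e (k + 1)))

theorem measurableSet_stepRegion (m δ : ℝ) (e : ℕ → ℕ → ℤ) (k : ℕ) :
    MeasurableSet (stepRegion m δ e k) := by
  have h := fun k => measurableSet_below (measurable_approx m δ e k)
  exact ((measurableSet_grid.inter (h _)).diff (h _)).union
    ((measurableSet_grid.inter (h _)).diff (h _))

theorem stepRegion_subset (m δ : ℝ) (e : ℕ → ℕ → ℤ) (k : ℕ) : stepRegion m δ e k ⊆ grid m := by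
  rintro p (h | h)
  · exact h.1.1
  · exact h.1.1

/-- The size of the corrections at level `k`. -/
def cost (e : ℕ → ℕ → ℤ) (k : ℕ) : ℝ := ∑ j ∈ Finset.range (2 ^ (k + 1) + 1), |(e k j : ℝ)|

theorem cost_nonneg (e : ℕ → ℕ → ℤ) (k : ℕ) : 0 ≤ cost e k :=
  Finset.sum_nonneg fun _ _ => abs_nonneg _

theorem volume_stepRegion_le {m δ : ℝ} (hm : 0 < m) (hδ : 0 ≤ δ) {e : ℕ → ℕ → ℤ} {k : ℕ}
    (he : ∀ j, 2 ^ (k + 1) < j → e k j = 0) :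
    volume.real (stepRegion m δ e k) ≤ 4 * δ * width m (k + 1) ^ 2 * cost e k := by
  have hw := width_pos hm (k + 1)
  have h1 := volume_real_le_sum_strips (A := stepRegion m δ e k) (measurable_approx m δ e k) hw
    (r := fun j => δ * width m (k + 1) * (|(e k j : ℝ)| + |(e k (j + 1) : ℝ)|))
    (fun j => by positivity) (N := 2 ^ (k + 1) + 1) (by
      intro p hp
      have hg := stepRegion_subset m δ e k hp
      have hu := (add_mem_Icc_of_mem_grid hg).1
      refine ⟨hu, floor_div_width_lt hm _ hg, ?_⟩
      have h2 := approx_succ hm δ e k hu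
      have h3 := abs_lin_le (q := fun j => (e k j : ℝ)) (div_nonneg hu hw.le)
      have h4 : |(p.2 - p.1) / 2 - approx m δ e k (p.1 + p.2)| ≤
          |approx m δ e (k + 1) (p.1 + p.2) - approx m δ e k (p.1 + p.2)| := by
        rcases hp with ⟨⟨_, ha⟩, hb⟩ | ⟨⟨_, ha⟩, hb⟩
        · rw [mem_below] at ha hb
          rw [abs_of_nonneg (by linarith), abs_of_nonneg (by linarith)]
          linarith
        · rw [mem_below] at ha hb
          rw [abs_of_nonpos (by linarith), abs_of_nonpos (by linarith)]
          linarith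
      refine h4.trans ?_
      rw [h2, add_sub_cancel_left, abs_mul, abs_of_nonneg (mul_nonneg hδ hw.le)]
      exact mul_le_mul_of_nonneg_left h3 (mul_nonneg hδ hw.le))
  refine h1.trans ?_
  -- The shifted sum reaches one node too far, where the correction is zero.
  have h5 : ∑ j ∈ Finset.range (2 ^ (k + 1) + 1), |(e k (j + 1) : ℝ)| ≤ cost e k := by
    rw [cost, Finset.sum_range_succ, Finset.sum_range_succ' _ (2 ^ (k + 1)),
      he (2 ^ (k + 1) + 1) (by omega)]
    simp
  have h6 : ∑ j ∈ Finset.range (2 ^ (k + 1) + 1), width m (k + 1) * (2 * (δ * width m (k + 1) *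
      (|(e k j : ℝ)| + |(e k (j + 1) : ℝ)|))) = 2 * δ * width m (k + 1) ^ 2 *
        (cost e k + ∑ j ∈ Finset.range (2 ^ (k + 1) + 1), |(e k (j + 1) : ℝ)|) := by
    rw [cost, ← Finset.sum_add_distrib, Finset.mul_sum]
    exact Finset.sum_congr rfl fun j _ => by ring
  rw [h6]
  have : 0 ≤ 2 * δ * width m (k + 1) ^ 2 := by positivity
  nlinarith

/-- The region of the grid close to the approximation at level `k`. -/
def bandRegion (m δ : ℝ) (e : ℕ → ℕ → ℤ) (k : ℕ) : Set (ℝ × ℝ) :=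
  grid m ∩ {p | |(p.2 - p.1) / 2 - approx m δ e k (p.1 + p.2)| ≤ 2 * width m k}

theorem measurableSet_bandRegion (m δ : ℝ) (e : ℕ → ℕ → ℤ) (k : ℕ) :
    MeasurableSet (bandRegion m δ e k) := by
  have h := measurable_approx m δ e k
  exact measurableSet_grid.inter (measurableSet_le
    (f := fun p : ℝ × ℝ => |(p.2 - p.1) / 2 - approx m δ e k (p.1 + p.2)|) (by fun_prop)
    measurable_const)

theorem volume_bandRegion_le {m : ℝ} (hm : 0 < m) (δ : ℝ) (e : ℕ → ℕ → ℤ) (k : ℕ) :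
    volume.real (bandRegion m δ e k) ≤ 32 * m ^ 2 / 2 ^ k := by
  have hw := width_pos hm k
  have h1 := volume_real_le_sum_strips (A := bandRegion m δ e k) (measurable_approx m δ e k) hw
    (r := fun _ => 2 * width m k) (fun j => by positivity) (N := 2 ^ k + 1) fun p hp =>
      ⟨(add_mem_Icc_of_mem_grid hp.1).1, floor_div_width_lt hm _ hp.1, hp.2⟩
  refine h1.trans ?_
  rw [Finset.sum_const, Finset.card_range, nsmul_eq_mul]
  have h2 : ((2 ^ k + 1 : ℕ) : ℝ) ≤ 2 * 2 ^ k := by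
    push_cast
    linarith [one_le_pow₀ (M₀ := ℝ) one_le_two (n := k)]
  have h3 : (0 : ℝ) ≤ width m k * (2 * (2 * width m k)) := by positivity
  refine (mul_le_mul_of_nonneg_right h2 h3).trans (le_of_eq ?_)
  simp only [width]
  field_simp
  ring

end

section

/-! ### The code of a profile -/

variable {m δ : ℝ} {h : ℝ → ℝ}

/-- The rounded value of a profile at a node. -/
def roundNode (m δ : ℝ) (h : ℝ → ℝ) (k j : ℕ) : ℤ := ⌊h (j * width m k) / (δ * width m k)⌋

/-- The corrections between the rounded values at consecutive levels. -/
def code (m δ : ℝ) (h : ℝ → ℝ) (k i : ℕ) : ℤ :=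
  if i ≤ 2 ^ (k + 1) then
    roundNode m δ h (k + 1) i - roundNode m δ h k (i / 2) - roundNode m δ h k ((i + 1) / 2)
  else 0

theorem code_of_lt {k i : ℕ} (hi : 2 ^ (k + 1) < i) : code m δ h k i = 0 :=
  if_neg (not_le.2 hi)

theorem two_pow_mul_width (m : ℝ) (k : ℕ) : 2 ^ k * width m k = 2 * m := by
  unfold width; field_simp

/-- The corrections telescope; the recursion starts correctly because a profile vanishes at 0 and
2m. -/
theorem dec_code (hh : IsProfile m h) (k : ℕ) {j : ℕ} (hj : j ≤ 2 ^ k) :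
    dec (code m δ h) k j = roundNode m δ h k j := by
  induction k generalizing j with
  | zero =>
    have h1 := two_pow_mul_width m 0
    rw [pow_zero, one_mul] at h1
    interval_cases j
    · simp [dec, roundNode, hh.left]
    · simp [dec, roundNode, h1, hh.right]
  | succ k ih =>
    rw [dec, ih (by rw [pow_succ] at hj; omega), ih (by rw [pow_succ] at hj; omega), code,
      if_pos hj]
    ring

/-- The slope of a profile on a dyadic interval. -/
def slopeAt (m : ℝ) (h : ℝ → ℝ) (k j : ℕ) : ℝ :=
  (h ((j + 1 : ℕ) * width m k) - h (j * width m k)) / width m k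

/-- The mean square slope at a dyadic level. -/
def energy (m : ℝ) (h : ℝ → ℝ) (k : ℕ) : ℝ :=
  (∑ j ∈ Finset.range (2 ^ k), slopeAt m h k j ^ 2) / 2 ^ k

theorem energy_nonneg (k : ℕ) : 0 ≤ energy m h k := by
  unfold energy; positivity

theorem IsProfile.energy_le (hh : IsProfile m h) (hm : 0 < m) (k : ℕ) :
    energy m h k ≤ 1 / 4 := by
  have hw := width_pos hm k
  have h1 : ∀ j ∈ Finset.range (2 ^ k), slopeAt m h k j ^ 2 ≤ 1 / 4 := by
    intro j _
    have h2 := hh.lipschitz ((j + 1 : ℕ) * width m k) (j * width m k)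
    have h3 : ((j + 1 : ℕ) : ℝ) * width m k - j * width m k = width m k := by push_cast; ring
    rw [h3, abs_of_pos hw] at h2
    have h4 : |slopeAt m h k j| ≤ 1 / 2 := by
      rw [slopeAt, abs_div, abs_of_pos hw, div_le_iff₀ hw]
      linarith
    rw [← sq_abs]
    nlinarith [abs_nonneg (slopeAt m h k j)]
  rw [energy, div_le_iff₀ (by positivity)]
  refine (Finset.sum_le_card_nsmul _ _ _ h1).trans (le_of_eq ?_)
  rw [Finset.card_range, nsmul_eq_mul]
  push_cast
  ring

theorem sum_range_two_mul (f : ℕ → ℝ) (N : ℕ) :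
    ∑ j ∈ Finset.range (2 * N), f j = ∑ j ∈ Finset.range N, (f (2 * j) + f (2 * j + 1)) := by
  induction N with
  | zero => simp
  | succ N ih =>
    rw [show 2 * (N + 1) = 2 * N + 1 + 1 by ring, Finset.sum_range_succ, Finset.sum_range_succ, ih,
      Finset.sum_range_succ]
    ring

/-- The change of slope in the middle of a dyadic interval. -/
def kink (m : ℝ) (h : ℝ → ℝ) (k j : ℕ) : ℝ :=
  (slopeAt m h (k + 1) (2 * j) - slopeAt m h (k + 1) (2 * j + 1)) / 2

theorem node_even (m : ℝ) (k j : ℕ) :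
    ((2 * j : ℕ) : ℝ) * width m (k + 1) = j * width m k := by
  rw [width_succ m k]; push_cast; ring

/-- A slope is the mean of the two slopes on its halves, and (a² + b²)/2 - ((a + b)/2)² = ((a -
b)/2)². -/
theorem energy_succ_sub (hm : 0 < m) (h : ℝ → ℝ) (k : ℕ) :
    (∑ j ∈ Finset.range (2 ^ k), kink m h k j ^ 2) = 2 ^ k * (energy m h (k + 1) - energy m h k) := by
  have hw := width_pos hm (k + 1)
  have h1 : ∀ j, slopeAt m h k j =
      (slopeAt m h (k + 1) (2 * j) + slopeAt m h (k + 1) (2 * j + 1)) / 2 := by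
    intro j
    have h2 := node_even m k j
    have h3 := node_even m k (j + 1)
    rw [show 2 * (j + 1) = 2 * j + 1 + 1 by ring] at h3
    rw [slopeAt, slopeAt, slopeAt, h2, h3, width_succ m k]
    field_simp
    ring
  have h4 : energy m h (k + 1) = (∑ j ∈ Finset.range (2 ^ k),
      (slopeAt m h (k + 1) (2 * j) ^ 2 + slopeAt m h (k + 1) (2 * j + 1) ^ 2) / 2) / 2 ^ k := by
    rw [energy, pow_succ', sum_range_two_mul, ← Finset.sum_div]
    rw [pow_succ']
    field_simp
  rw [h4, energy, mul_sub, mul_div_cancel₀ _ (by positivity), mul_div_cancel₀ _ (by positivity),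
    ← Finset.sum_sub_distrib]
  refine Finset.sum_congr rfl fun j _ => ?_
  rw [h1 j, kink]
  ring

/-- Both levels round the same value in units differing by a factor 2, and ⌊2x⌋ - 2⌊x⌋ is 0 or 1. -/
theorem abs_code_even_le {k j : ℕ} (hm : 0 < m) (hδ : 0 < δ) (hj : j ≤ 2 ^ k) :
    |(code m δ h k (2 * j) : ℝ)| ≤ 1 := by
  have hw := width_pos hm (k + 1)
  rw [code, if_pos (by rw [pow_succ']; omega), show 2 * j / 2 = j by omega,
    show (2 * j + 1) / 2 = j by omega, roundNode, roundNode, node_even]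
  set x := h (j * width m k) / (δ * width m k) with hx
  have hy : h (j * width m k) / (δ * width m (k + 1)) = 2 * x := by
    rw [hx, width_succ m k]; field_simp
  rw [hy]
  have a1 := Int.floor_le x
  have a2 := Int.lt_floor_add_one x
  have b1 := Int.floor_le (2 * x)
  have b2 := Int.lt_floor_add_one (2 * x)
  have c1 : ⌊2 * x⌋ - ⌊x⌋ - ⌊x⌋ < 2 := by
    exact_mod_cast (by linarith : (⌊2 * x⌋ : ℝ) - ⌊x⌋ - ⌊x⌋ < 2)
  have c2 : -1 < ⌊2 * x⌋ - ⌊x⌋ - ⌊x⌋ := by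
    exact_mod_cast (by linarith : (-1 : ℝ) < (⌊2 * x⌋ : ℝ) - ⌊x⌋ - ⌊x⌋)
  have c3 : |⌊2 * x⌋ - ⌊x⌋ - ⌊x⌋| ≤ 1 := abs_le.2 ⟨by omega, by omega⟩
  exact_mod_cast c3

/-- Before rounding, the correction at a midpoint is d = kink/δ. Rounding changes it by at most 2,
and |d| ≤ 1 + d² passes to the square, which the energy controls. -/
theorem abs_code_odd_le {k j : ℕ} (hm : 0 < m) (hδ : 0 < δ) (hj : j < 2 ^ k) :
    |(code m δ h k (2 * j + 1) : ℝ)| ≤ 3 + kink m h k j ^ 2 / δ ^ 2 := by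
  have hw := width_pos hm (k + 1)
  rw [code, if_pos (by rw [pow_succ']; omega), show (2 * j + 1) / 2 = j by omega,
    show (2 * j + 1 + 1) / 2 = j + 1 by omega, roundNode, roundNode, roundNode]
  set x := h (j * width m k) / (δ * width m k) with hx
  set y := h ((j + 1 : ℕ) * width m k) / (δ * width m k) with hy
  set z := h ((2 * j + 1 : ℕ) * width m (k + 1)) / (δ * width m (k + 1)) with hz
  have hd : z - x - y = kink m h k j / δ := by
    have h3 := node_even m k (j + 1)
    rw [show 2 * (j + 1) = 2 * j + 1 + 1 by ring] at h3
    rw [kink, slopeAt, slopeAt, h3, node_even, hx, hy, hz, width_succ m k]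
    field_simp
    ring
  set d := kink m h k j / δ with hdd
  have a1 := Int.floor_le x
  have a2 := Int.lt_floor_add_one x
  have b1 := Int.floor_le y
  have b2 := Int.lt_floor_add_one y
  have c1 := Int.floor_le z
  have c2 := Int.lt_floor_add_one z
  have hs : kink m h k j ^ 2 / δ ^ 2 = d ^ 2 := by rw [hdd, div_pow]
  rw [hs]
  push_cast
  refine abs_le.2 ⟨?_, ?_⟩ <;> nlinarith [sq_nonneg (d - 1), sq_nonneg (d + 1)]

theorem cost_code_le (hm : 0 < m) (hδ : 0 < δ) (h : ℝ → ℝ) (k : ℕ) :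
    cost (code m δ h) k ≤ 2 ^ k * (5 + (energy m h (k + 1) - energy m h k) / δ ^ 2) := by
  rw [cost, Finset.sum_range_succ, pow_succ', sum_range_two_mul]
  have h1 : ∑ j ∈ Finset.range (2 ^ k), (|(code m δ h k (2 * j) : ℝ)| +
      |(code m δ h k (2 * j + 1) : ℝ)|) ≤
      ∑ j ∈ Finset.range (2 ^ k), (4 + kink m h k j ^ 2 / δ ^ 2) := by
    refine Finset.sum_le_sum fun j hj => ?_
    have hj' := Finset.mem_range.1 hj
    linarith [abs_code_even_le (h := h) hm hδ hj'.le, abs_code_odd_le (h := h) hm hδ hj']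
  have h2 := abs_code_even_le (h := h) hm hδ (le_refl (2 ^ k))
  have h4 : ∑ j ∈ Finset.range (2 ^ k), (4 + kink m h k j ^ 2 / δ ^ 2) =
      2 ^ k * 4 + 2 ^ k * (energy m h (k + 1) - energy m h k) / δ ^ 2 := by
    rw [Finset.sum_add_distrib, ← Finset.sum_div, energy_succ_sub hm h k]
    simp
  rw [h4] at h1
  have h3 : (1 : ℝ) ≤ 2 ^ k := one_le_pow₀ one_le_two
  rw [mul_add, ← mul_div_assoc]
  linarith

theorem abs_sub_roundNode_le (hh : IsProfile m h) (hm : 0 < m) (hδ : 0 < δ) (hδ1 : δ ≤ 1)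
    {k j : ℕ} {u : ℝ} (hu : |u - j * width m k| ≤ width m k) :
    |h u / (δ * width m k) - roundNode m δ h k j| ≤ 2 / δ := by
  have hw := width_pos hm k
  have h1 := abs_le.1 (hh.lipschitz u (j * width m k))
  have a1 := Int.floor_le (h (j * width m k) / (δ * width m k))
  have a2 := Int.lt_floor_add_one (h (j * width m k) / (δ * width m k))
  have h2 : |h u / (δ * width m k) - h (j * width m k) / (δ * width m k)| ≤ 1 / δ := by
    rw [← sub_div, abs_div, abs_of_pos (mul_pos hδ hw), div_le_div_iff₀ (mul_pos hδ hw) hδ]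
    have : |h u - h (j * width m k)| ≤ width m k := abs_le.2 ⟨by linarith, by linarith⟩
    nlinarith
  have h3 := abs_le.1 h2
  have h4 : 1 ≤ 1 / δ := by rw [le_div_iff₀ hδ]; linarith
  have h5 : 2 / δ = 1 / δ + 1 / δ := by ring
  rw [h5, roundNode]
  exact abs_le.2 ⟨by linarith, by linarith⟩

/-- Interpolation is a convex combination of two node values, each within 2 w_k of h(u): Lipschitz
variation and rounding each cost at most w_k. -/
theorem abs_sub_approx_code_le (hh : IsProfile m h) (hm : 0 < m) (hδ : 0 < δ) (hδ1 : δ ≤ 1)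
    (k : ℕ) {u : ℝ} (hu : u ∈ Set.Icc 0 (2 * m)) :
    |h u - approx m δ (code m δ h) k u| ≤ 2 * width m k := by
  have hw := width_pos hm k
  have hx0 : 0 ≤ u / width m k := div_nonneg hu.1 hw.le
  have key : |h u / (δ * width m k) -
      lin (fun j => (dec (code m δ h) k j : ℝ)) (u / width m k)| ≤ 2 / δ := by
    have hfl := Nat.floor_le hx0
    have hfl' := Nat.lt_floor_add_one (u / width m k)
    rcases hu.2.lt_or_eq with hlt | heq
    · have hlt' : ⌊u / width m k⌋₊ < 2 ^ k := by
        rw [Nat.floor_lt hx0, div_lt_iff₀ hw]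
        push_cast
        rwa [two_pow_mul_width]
      rw [le_div_iff₀ hw] at hfl
      rw [div_lt_iff₀ hw] at hfl'
      refine abs_sub_lin_le hx0 ?_ ?_
      · rw [dec_code hh k hlt'.le]
        refine abs_sub_roundNode_le hh hm hδ hδ1 (abs_le.2 ⟨?_, ?_⟩) <;> linarith
      · rw [dec_code hh k hlt']
        refine abs_sub_roundNode_le hh hm hδ hδ1 (abs_le.2 ⟨?_, ?_⟩) <;> push_cast <;> linarith
    -- At the right endpoint the node after the last one, where `dec` is not controlled, has weight
    -- zero.
    · have hx : u / width m k = ((2 ^ k : ℕ) : ℝ) := by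
        rw [heq, ← two_pow_mul_width m k]
        push_cast
        field_simp
      rw [hx, lin_eq_of_mem (j := 2 ^ k) le_rfl (by linarith), sub_self, sub_zero, one_mul,
        zero_mul, add_zero, dec_code hh k le_rfl]
      refine abs_sub_roundNode_le hh hm hδ hδ1 ?_
      rw [← hx, div_mul_cancel₀ _ hw.ne', sub_self, abs_zero]
      exact hw.le
  have h1 : h u - approx m δ (code m δ h) k u = δ * width m k * (h u / (δ * width m k) -
      lin (fun j => (dec (code m δ h) k j : ℝ)) (u / width m k)) := by
    rw [approx, mul_sub, mul_div_cancel₀ _ (mul_pos hδ hw).ne']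
  rw [h1, abs_mul, abs_of_pos (mul_pos hδ hw)]
  refine (mul_le_mul_of_nonneg_left key (mul_pos hδ hw).le).trans (le_of_eq ?_)
  field_simp

end

section

/-! ### Weighted union bound over codes -/

variable {Ω : Type*} [MeasurableSpace Ω] {P : Measure Ω} {m : ℝ}

theorem sum_exp_neg_abs_le (B : ℕ) :
    ∑ n ∈ Finset.Icc (-(B : ℤ)) B, Real.exp (-|(n : ℝ)|) ≤ 4 - 2 * (1 / 2) ^ B := by
  induction B with
  | zero => simp; norm_num
  | succ B ih =>
    have h1 : Finset.Icc (-((B + 1 : ℕ) : ℤ)) ((B + 1 : ℕ) : ℤ) =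
        insert (-((B + 1 : ℕ) : ℤ)) (insert ((B + 1 : ℕ) : ℤ) (Finset.Icc (-(B : ℤ)) B)) := by
      ext n
      simp only [Finset.mem_Icc, Finset.mem_insert]
      push_cast
      omega
    have he : Real.exp (-|((B + 1 : ℕ) : ℝ)|) ≤ (1 / 2) ^ (B + 1) := by
      rw [abs_of_nonneg (Nat.cast_nonneg _), ← mul_neg_one, Real.exp_nat_mul]
      refine pow_le_pow_left₀ (Real.exp_pos _).le ?_ _
      rw [Real.exp_neg, ← one_div]
      exact one_div_le_one_div_of_le two_pos (by linarith [Real.add_one_le_exp (1 : ℝ)])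
    rw [h1, Finset.sum_insert (by simp; omega), Finset.sum_insert (by simp)]
    push_cast at he ⊢
    rw [abs_neg]
    rw [pow_succ] at he ⊢
    linarith

/-- The positions of the corrections below level `k`. -/
def codeIndex (k : ℕ) : Finset (Σ _ : ℕ, ℕ) :=
  (Finset.range k).sigma fun i => Finset.range (2 ^ (i + 1) + 1)

theorem card_codeIndex_le (k : ℕ) : (codeIndex k).card ≤ 4 * 2 ^ k := by
  rw [codeIndex, Finset.card_sigma]
  simp only [Finset.card_range]
  induction k with
  | zero => simp
  | succ k ih =>
    rw [Finset.sum_range_succ, pow_succ]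
    have := Nat.one_le_two_pow (n := k)
    omega

/-- The total size of the corrections below level `k`. -/
def totalCost (e : ℕ → ℕ → ℤ) (k : ℕ) : ℝ := ∑ i ∈ Finset.range k, cost e i

theorem totalCost_eq (e : ℕ → ℕ → ℤ) (k : ℕ) :
    totalCost e k = ∑ x : codeIndex k, |(e x.1.1 x.1.2 : ℝ)| := by
  rw [Finset.sum_coe_sort (codeIndex k) fun x => |(e x.1 x.2 : ℝ)|, codeIndex, Finset.sum_sigma]
  rfl

/-- The corrections with a given restriction to the positions below level `k`. -/
def extendCode {k : ℕ} (c : codeIndex k → ℤ) (i j : ℕ) : ℤ :=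
  if hx : ⟨i, j⟩ ∈ codeIndex k then c ⟨⟨i, j⟩, hx⟩ else 0

/-- Families of corrections that vanish off the dyadic nodes. -/
def IsCode (e : ℕ → ℕ → ℤ) : Prop := ∀ i j, 2 ^ (i + 1) < j → e i j = 0

theorem isCode_extendCode {k : ℕ} (c : codeIndex k → ℤ) : IsCode (extendCode c) := by
  intro i j hij
  refine dif_neg fun h => ?_
  rw [codeIndex, Finset.mem_sigma, Finset.mem_range, Finset.mem_range] at h
  have := h.2
  simp only at this
  omega

theorem extendCode_restrict {e : ℕ → ℕ → ℤ} (he : IsCode e) {k i : ℕ} (hi : i < k) (j : ℕ) :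
    e i j = extendCode (fun x : codeIndex k => e x.1.1 x.1.2) i j := by
  rw [extendCode]
  split_ifs with h
  · rfl
  · refine he i j ?_
    rw [codeIndex, Finset.mem_sigma, Finset.mem_range, Finset.mem_range] at h
    by_contra hj
    exact h ⟨hi, by simp only; omega⟩

/-- Only the corrections below level `k` matter, at most 4·2^k integers. Each adds |c| + 2 to the
threshold, hence the term 8·2^k. The cutoff `B` only makes the union finite and does not enter the
bound. -/
theorem measureReal_exists_code_le [IsFiniteMeasure P] (k B : ℕ) {X : (ℕ → ℕ → ℤ) → Ω → ℝ}
    {b : (ℕ → ℕ → ℤ) → ℝ}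
    (hX : ∀ e, IsCode e → ∀ s, P.real {ω | b e + s ≤ X e ω} ≤ Real.exp (-s))
    (hXb : ∀ e e' : ℕ → ℕ → ℤ, (∀ i < k, ∀ j, e i j = e' i j) → X e = X e' ∧ b e = b e')
    (t : ℝ) :
    P.real {ω | ∃ e : ℕ → ℕ → ℤ, IsCode e ∧ (∀ i < k, ∀ j, |e i j| ≤ B) ∧
      b e + (totalCost e k + 8 * 2 ^ k + t) ≤ X e ω} ≤ Real.exp (-t) := by
  classical
  let C : Finset (codeIndex k → ℤ) := Fintype.piFinset fun _ => Finset.Icc (-(B : ℤ)) B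
  have hcard : ((codeIndex k).card : ℝ) * 2 ≤ 8 * 2 ^ k := by
    have := card_codeIndex_le k
    have h2 : ((codeIndex k).card : ℝ) ≤ 4 * 2 ^ k := by exact_mod_cast this
    linarith
  have hsub : {ω | ∃ e : ℕ → ℕ → ℤ, IsCode e ∧ (∀ i < k, ∀ j, |e i j| ≤ B) ∧
      b e + (totalCost e k + 8 * 2 ^ k + t) ≤ X e ω} ⊆
      ⋃ c ∈ C, {ω | b (extendCode c) + (∑ x, (|(c x : ℝ)| + 2) + t) ≤ X (extendCode c) ω} := by
    rintro ω ⟨e, he, hB, hω⟩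
    simp only [Set.mem_iUnion]
    have hr := fun i (hi : i < k) j => extendCode_restrict he hi j
    refine ⟨fun x => e x.1.1 x.1.2, ?_, ?_⟩
    · refine Fintype.mem_piFinset.2 fun x => ?_
      have hx : x.1.1 < k := Finset.mem_range.1 (Finset.mem_sigma.1 x.2).1
      exact Finset.mem_Icc.2 (abs_le.1 (hB _ hx _))
    · obtain ⟨h1, h2⟩ := hXb _ _ hr
      rw [Set.mem_ofPred_eq]
      rw [← h1, ← h2, Finset.sum_add_distrib, ← totalCost_eq]
      refine le_trans ?_ hω
      simp only [Finset.sum_const, Finset.card_univ, Fintype.card_coe, nsmul_eq_mul]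
      linarith
  refine (measureReal_mono hsub (measure_ne_top _ _)).trans
    ((measureReal_biUnion_finset_le _ _).trans ?_)
  have h1 : ∀ c ∈ C, P.real {ω | b (extendCode c) + (∑ x, (|(c x : ℝ)| + 2) + t) ≤
      X (extendCode c) ω} ≤ (∏ x, (Real.exp (-2) * Real.exp (-|(c x : ℝ)|))) * Real.exp (-t) := by
    intro c _
    refine (hX _ (isCode_extendCode c) _).trans (le_of_eq ?_)
    rw [neg_add, Real.exp_add, ← Finset.sum_neg_distrib, Real.exp_sum]
    congr 1
    refine Finset.prod_congr rfl fun x _ => ?_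
    rw [← Real.exp_add]
    congr 1
    ring
  refine (Finset.sum_le_sum h1).trans ?_
  -- The sum over codes factorises over positions, and each factor is at most 4e⁻² ≤ 1.
  rw [← Finset.sum_mul, ← Finset.prod_univ_sum (fun _ => Finset.Icc (-(B : ℤ)) B)
    (fun _ n => Real.exp (-2) * Real.exp (-|(n : ℝ)|))]
  refine mul_le_of_le_one_left (Real.exp_pos _).le ?_
  refine Finset.prod_le_one (fun _ _ => Finset.sum_nonneg fun _ _ => by positivity) fun _ _ => ?_
  rw [← Finset.mul_sum]
  have h2 := sum_exp_neg_abs_le B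
  have h3 : (4 : ℝ) ≤ Real.exp 2 := by
    have := Real.add_one_le_exp (1 : ℝ)
    have h4 : Real.exp 2 = Real.exp 1 * Real.exp 1 := by rw [← Real.exp_add]; norm_num
    rw [h4]; nlinarith
  have h5 : (0 : ℝ) ≤ 2 * (1 / 2) ^ B := by positivity
  rw [Real.exp_neg, inv_mul_le_iff₀ (Real.exp_pos _)]
  linarith

end

section

/-! ### Tail bounds along the dyadic chain -/

variable {Ω : Type*} [MeasurableSpace Ω] {P : Measure Ω} {m : ℝ} {blue red : Ω → Dots}

/-- The indicator of the part of the grid below a graph. -/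
def belowInd (m : ℝ) (h : ℝ → ℝ) : ℝ × ℝ → ℝ := (grid m ∩ below h).indicator 1

theorem measurable_belowInd {h : ℝ → ℝ} (hh : Measurable h) : Measurable (belowInd m h) :=
  measurable_one.indicator (measurableSet_grid.inter (measurableSet_below hh))

/-- The weighted surplus: the sum of a weight over the blue dots minus that over the red dots. -/
def net (blue red : Dots) (f : ℝ × ℝ → ℝ) : ℝ := dotSum blue f - dotSum red f

theorem net_sub (b r : Dots) (f g : ℝ × ℝ → ℝ) :
    net b r (fun p => f p - g p) = net b r f - net b r g := by
  simp only [net, dotSum_sub]; ring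

theorem IsPathSurplusProblem.aemeasurable_dotSum (h : IsPathSurplusProblem P m blue red)
    {f : ℝ × ℝ → ℝ} (hf : Measurable f) :
    AEMeasurable (fun ω => dotSum (blue ω) f) P ∧ AEMeasurable (fun ω => dotSum (red ω) f) P :=
  ⟨(measurable_dotSum hf).comp_aemeasurable h.blue_dots.aemeasurable,
    (measurable_dotSum hf).comp_aemeasurable h.red_dots.aemeasurable⟩

theorem abs_belowInd_le (m : ℝ) (h : ℝ → ℝ) (p : ℝ × ℝ) :
    |belowInd m h p| ≤ (grid m).indicator 1 p := by
  classical
  rw [belowInd, Set.indicator_apply, Set.indicator_apply]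
  split_ifs with h1 h2
  · simp
  · exact absurd h1.1 h2
  · simp
  · simp

theorem abs_belowInd_step_le (m δ : ℝ) (e : ℕ → ℕ → ℤ) (k : ℕ) (p : ℝ × ℝ) :
    |belowInd m (approx m δ e (k + 1)) p - belowInd m (approx m δ e k) p| ≤
      (stepRegion m δ e k).indicator 1 p := by
  classical
  by_cases h1 : p ∈ grid m <;> by_cases h2 : p ∈ below (approx m δ e (k + 1)) <;>
    by_cases h3 : p ∈ below (approx m δ e k) <;>
    simp [belowInd, stepRegion, h1, h2, h3]

theorem IsPathSurplusProblem.initial_tail [IsProbabilityMeasure P]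
    (h : IsPathSurplusProblem P m blue red) (hm : 0 < m) {θ : ℝ} (h0 : 0 ≤ θ) (h1 : θ ≤ 1)
    {g : ℝ → ℝ} (hg : Measurable g) (s : ℝ) :
    P.real {ω | 2 * θ ^ 2 * m ^ 2 + s ≤ θ * net (blue ω) (red ω) (belowInd m g)} ≤
      Real.exp (-s) := by
  have hf := measurable_belowInd (m := m) hg
  obtain ⟨i1, i2⟩ := h.aemeasurable_dotSum hf
  refine measureReal_le_exp_of_lintegral_exp_le ((i1.sub i2).const_mul θ) ?_
  refine (h.lintegral_exp_sub_le hm hf measurableSet_grid subset_rfl (abs_belowInd_le m _)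
    h0 h1).trans (le_of_eq ?_)
  rw [measureReal_def, volume_grid hm.le, ENNReal.toReal_ofReal (sq_nonneg m)]

theorem IsPathSurplusProblem.step_tail [IsProbabilityMeasure P]
    (h : IsPathSurplusProblem P m blue red) (hm : 0 < m) {θ δ : ℝ} (hδ : 0 ≤ δ) (h0 : 0 ≤ θ)
    (h1 : θ ≤ 1) {e : ℕ → ℕ → ℤ} (he : IsCode e) (k : ℕ) (s : ℝ) :
    P.real {ω | 8 * δ * (θ * width m (k + 1)) ^ 2 * cost e k + s ≤
      θ * net (blue ω) (red ω) (fun p => belowInd m (approx m δ e (k + 1)) p -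
        belowInd m (approx m δ e k) p)} ≤ Real.exp (-s) := by
  have hf : Measurable (fun p => belowInd m (approx m δ e (k + 1)) p -
        belowInd m (approx m δ e k) p) :=
    (measurable_belowInd (measurable_approx _ _ _ _)).sub
      (measurable_belowInd (measurable_approx _ _ _ _))
  obtain ⟨i1, i2⟩ := h.aemeasurable_dotSum hf
  refine measureReal_le_exp_of_lintegral_exp_le ((i1.sub i2).const_mul θ) ?_
  refine (h.lintegral_exp_sub_le hm hf (measurableSet_stepRegion m δ e k)
    (stepRegion_subset m δ e k) (abs_belowInd_step_le m δ e k) h0 h1).trans ?_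
  refine ENNReal.ofReal_le_ofReal (Real.exp_le_exp.2 ?_)
  refine (mul_le_mul_of_nonneg_left (volume_stepRegion_le hm hδ (he k)) (by positivity)).trans
    (le_of_eq ?_)
  ring

theorem IsPathSurplusProblem.band_tail [IsProbabilityMeasure P]
    (h : IsPathSurplusProblem P m blue red) (hm : 0 < m) {θ : ℝ} (δ : ℝ) (h0 : 0 ≤ θ)
    (h1 : θ ≤ 1) (e : ℕ → ℕ → ℤ) (k : ℕ) (s : ℝ) :
    P.real {ω | 4 * θ * (32 * m ^ 2 / 2 ^ k) + s ≤
      θ * (dotSum (blue ω) ((bandRegion m δ e k).indicator 1) +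
        dotSum (red ω) ((bandRegion m δ e k).indicator 1))} ≤ Real.exp (-s) := by
  have hA := measurableSet_bandRegion m δ e k
  obtain ⟨i1, i2⟩ := h.aemeasurable_dotSum
    (measurable_one.indicator hA : Measurable ((bandRegion m δ e k).indicator (1 : ℝ × ℝ → ℝ)))
  refine measureReal_le_exp_of_lintegral_exp_le ((i1.add i2).const_mul θ) ?_
  refine (h.lintegral_exp_add_le hm hA Set.inter_subset_left h0 h1).trans ?_
  refine ENNReal.ofReal_le_ofReal (Real.exp_le_exp.2 ?_)
  exact mul_le_mul_of_nonneg_left (volume_bandRegion_le hm δ e k) (by positivity)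

/-- The two indicators differ only at points between the graphs, and these lie in the band. -/
theorem net_belowInd_le_add_band (b r : Dots) {h : ℝ → ℝ} {δ : ℝ} {e : ℕ → ℕ → ℤ} {n : ℕ}
    (hband : ∀ u ∈ Set.Icc 0 (2 * m), |h u - approx m δ e n u| ≤ 2 * width m n) :
    net b r (belowInd m h) ≤ net b r (belowInd m (approx m δ e n)) +
      (dotSum b ((bandRegion m δ e n).indicator 1) +
        dotSum r ((bandRegion m δ e n).indicator 1)) := by
  classical
  have key : ∀ p, |belowInd m h p - belowInd m (approx m δ e n) p| ≤
      (bandRegion m δ e n).indicator 1 p := by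
    intro p
    by_cases h1 : p ∈ grid m
    · have hb := hband _ (add_mem_Icc_of_mem_grid h1)
      have hmem : ∀ _ : |(p.2 - p.1) / 2 - approx m δ e n (p.1 + p.2)| ≤ 2 * width m n,
          p ∈ bandRegion m δ e n := fun hp => ⟨h1, hp⟩
      by_cases h2 : p ∈ below h <;> by_cases h3 : p ∈ below (approx m δ e n)
      · simp [belowInd, Set.indicator_apply, h1, h2, h3]
        split_ifs <;> simp
      · have h4 : p ∈ bandRegion m δ e n := by
          rw [mem_below] at h2 h3
          refine hmem (le_trans ?_ hb)
          rw [abs_of_nonneg (by linarith), abs_of_nonneg (by linarith)]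
          linarith
        simp [belowInd, h1, h2, h3, h4]
      · have h4 : p ∈ bandRegion m δ e n := by
          rw [mem_below] at h2 h3
          refine hmem (le_trans ?_ hb)
          rw [abs_of_nonpos (by linarith), abs_of_nonpos (by linarith)]
          linarith
        simp [belowInd, h1, h2, h3, h4]
      · simp [belowInd, Set.indicator_apply, h1, h2, h3]
        split_ifs <;> simp
    · simp [belowInd, Set.indicator_apply, h1]
      split_ifs <;> simp
  have hD : ∀ D : Dots, |dotSum D (belowInd m h) - dotSum D (belowInd m (approx m δ e n))| ≤
      dotSum D ((bandRegion m δ e n).indicator 1) := by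
    intro D
    rw [← dotSum_sub]
    exact (Finset.abs_sum_le_sum_abs _ _).trans (Finset.sum_le_sum fun i _ => key _)
  have hb := (abs_le.1 (hD b)).2
  have hr := (abs_le.1 (hD r)).1
  simp only [net]
  linarith

/-- Summation of the geometric weights of cumulated sizes. -/
theorem sum_totalCost_le (e : ℕ → ℕ → ℤ) (n : ℕ) :
    ∑ k ∈ Finset.range n, totalCost e (k + 1) / 2 ^ k + 2 * (totalCost e n / 2 ^ n) =
      2 * ∑ k ∈ Finset.range n, cost e k / 2 ^ k := by
  induction n with
  | zero => simp [totalCost]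
  | succ n ih =>
    rw [Finset.sum_range_succ, Finset.sum_range_succ, mul_add, ← ih]
    simp only [totalCost, Finset.sum_range_succ]
    rw [pow_succ]
    field_simp
    ring

/-- The energy increments telescope, so 1/δ² is paid once and not once per level. -/
theorem sum_cost_code_le {h : ℝ → ℝ} {δ : ℝ} (hh : IsProfile m h) (hm : 0 < m) (hδ : 0 < δ)
    (n : ℕ) : ∑ k ∈ Finset.range n, cost (code m δ h) k / 2 ^ k ≤ 5 * n + 1 / δ ^ 2 := by
  have h1 : ∀ k ∈ Finset.range n, cost (code m δ h) k / 2 ^ k ≤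
      5 + (energy m h (k + 1) - energy m h k) / δ ^ 2 := by
    intro k _
    rw [div_le_iff₀ (by positivity), mul_comm]
    exact cost_code_le hm hδ h k
  refine (Finset.sum_le_sum h1).trans ?_
  rw [Finset.sum_add_distrib, ← Finset.sum_div, Finset.sum_range_sub, Finset.sum_const,
    Finset.card_range, nsmul_eq_mul, mul_comm (n : ℝ)]
  have h2 : energy m h n - energy m h 0 ≤ 1 := by
    linarith [hh.energy_le hm n, energy_nonneg (m := m) (h := h) 0]
  gcongr

theorem cost_code_le_two_pow {h : ℝ → ℝ} {δ : ℝ} (hh : IsProfile m h) (hm : 0 < m) (hδ : 0 < δ)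
    {k n : ℕ} (hk : k ≤ n) : cost (code m δ h) k ≤ 2 ^ n * (5 + 1 / δ ^ 2) := by
  refine (cost_code_le hm hδ h k).trans ?_
  have h2 : energy m h (k + 1) - energy m h k ≤ 1 := by
    linarith [hh.energy_le hm (k + 1), energy_nonneg (m := m) (h := h) k]
  have h3 : (5 + (energy m h (k + 1) - energy m h k) / δ ^ 2) ≤ 5 + 1 / δ ^ 2 := by gcongr
  have h4 : (2 : ℝ) ^ k ≤ 2 ^ n := pow_le_pow_right₀ one_le_two hk
  have h5 : (0 : ℝ) ≤ 5 + 1 / δ ^ 2 := by positivity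
  nlinarith [pow_pos (two_pos : (0 : ℝ) < 2) k]

/-- A crude bound suffices: it only supplies the cutoff for the union bound. -/
theorem abs_code_le {h : ℝ → ℝ} {δ : ℝ} (hh : IsProfile m h) (hm : 0 < m) (hδ : 0 < δ)
    {k n : ℕ} (hk : k ≤ n) (j : ℕ) :
    |code m δ h k j| ≤ (⌈(2 : ℝ) ^ n * (5 + 1 / δ ^ 2)⌉₊ : ℤ) := by
  rcases lt_or_ge (2 ^ (k + 1)) j with hj | hj
  · rw [code_of_lt hj, abs_zero]
    positivity
  · have h1 : |(code m δ h k j : ℝ)| ≤ cost (code m δ h) k :=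
      Finset.single_le_sum (f := fun j => |(code m δ h k j : ℝ)|) (fun _ _ => abs_nonneg _)
        (Finset.mem_range.2 (by omega))
    have h2 := (h1.trans (cost_code_le_two_pow hh hm hδ hk)).trans (Nat.le_ceil _)
    exact_mod_cast h2

end

/-! ### Assembling the chain: tail bound and mean. -/

section

variable {Ω : Type*} [MeasurableSpace Ω] {P : Measure Ω} {m : ℝ} {blue red : Ω → Dots}

theorem sum_range_one_div_two_pow_le (n : ℕ) : ∑ k ∈ Finset.range n, (1 : ℝ) / 2 ^ k ≤ 2 := by
  have h : ∑ k ∈ Finset.range n, (1 : ℝ) / 2 ^ k = 2 - 2 / 2 ^ n := by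
    induction n with
    | zero => simp
    | succ n ih => rw [Finset.sum_range_succ, ih, pow_succ]; field_simp; ring
  have : (0 : ℝ) ≤ 2 / 2 ^ n := by positivity
  linarith

/-- Adding up the level-by-level bounds along the chain of a profile. -/
theorem net_belowInd_le_of_levels {h : ℝ → ℝ} (hh : IsProfile m h) (hm : 0 < m) {l : ℝ}
    (hl : 1 ≤ l) {n : ℕ} (h2 : m / l < 2 ^ (n + 1)) (hn : (n : ℝ) ≤ l ^ 4) {t : ℝ} (ht : 0 ≤ t)
    (b r : Dots)
    (hinit : net b r (belowInd m fun _ => 0) ≤ m / l * (2 * l ^ 2 + t))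
    (hstep : ∀ k < n, net b r (fun p =>
        belowInd m (approx m (1 / l ^ 2) (code m (1 / l ^ 2) h) (k + 1)) p -
          belowInd m (approx m (1 / l ^ 2) (code m (1 / l ^ 2) h) k) p) ≤
      m / l / 2 ^ k * (8 * cost (code m (1 / l ^ 2) h) k +
        (totalCost (code m (1 / l ^ 2) h) (k + 1) + 8 * 2 ^ (k + 1) + t)))
    (hlast : dotSum b ((bandRegion m (1 / l ^ 2) (code m (1 / l ^ 2) h) n).indicator 1) +
        dotSum r ((bandRegion m (1 / l ^ 2) (code m (1 / l ^ 2) h) n).indicator 1) ≤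
      m / l / 2 ^ n * (128 * m * l + (totalCost (code m (1 / l ^ 2) h) n + 8 * 2 ^ n + t))) :
    net b r (belowInd m h) ≤ 390 * m * l ^ 3 + 4 * (m / l) * t := by
  have hl0 : 0 < l := by linarith
  have hδ : 0 < 1 / l ^ 2 := by positivity
  have hδ1 : 1 / l ^ 2 ≤ 1 := by
    rw [div_le_one (by positivity)]; exact one_le_pow₀ hl
  set e := code m (1 / l ^ 2) h with he
  set M := m / l with hM
  have hM0 : 0 < M := by positivity
  have hband := net_belowInd_le_add_band b r (e := e) (n := n)
    fun u hu => abs_sub_approx_code_le hh hm hδ hδ1 n hu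
  have htel : net b r (belowInd m (approx m (1 / l ^ 2) e n)) =
      net b r (belowInd m fun _ => 0) + ∑ k ∈ Finset.range n, net b r (fun p =>
        belowInd m (approx m (1 / l ^ 2) e (k + 1)) p - belowInd m (approx m (1 / l ^ 2) e k) p) := by
    simp only [net_sub]
    rw [Finset.sum_range_sub (fun k => net b r (belowInd m (approx m (1 / l ^ 2) e k))),
      show approx m (1 / l ^ 2) e 0 = fun _ => 0 from funext fun u => approx_zero _ _ _ u]
    ring
  have hsum : ∑ k ∈ Finset.range n, net b r (fun p =>
        belowInd m (approx m (1 / l ^ 2) e (k + 1)) p -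
          belowInd m (approx m (1 / l ^ 2) e k) p) ≤
      ∑ k ∈ Finset.range n, M * (9 * (totalCost e (k + 1) / 2 ^ k) + 16 + t * (1 / 2 ^ k)) := by
    refine Finset.sum_le_sum fun k hk => (hstep k (Finset.mem_range.1 hk)).trans ?_
    have h3 : cost e k ≤ totalCost e (k + 1) := by
      rw [totalCost, Finset.sum_range_succ]
      linarith [Finset.sum_nonneg fun i (_ : i ∈ Finset.range k) => cost_nonneg e i]
    have h4 : M * (9 * (totalCost e (k + 1) / 2 ^ k) + 16 + t * (1 / 2 ^ k)) =
        M / 2 ^ k * (9 * totalCost e (k + 1) + 8 * 2 ^ (k + 1) + t) := by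
      rw [pow_succ]; field_simp; ring
    rw [h4]
    exact mul_le_mul_of_nonneg_left (by linarith) (by positivity)
  rw [← Finset.mul_sum, Finset.sum_add_distrib, Finset.sum_add_distrib, ← Finset.mul_sum,
    ← Finset.mul_sum, Finset.sum_const, Finset.card_range, nsmul_eq_mul] at hsum
  have hS := sum_totalCost_le e n
  have hC : ∑ k ∈ Finset.range n, cost e k / 2 ^ k ≤ 5 * n + 1 / (1 / l ^ 2) ^ 2 :=
    sum_cost_code_le hh hm hδ n
  have hC' : 1 / (1 / l ^ 2) ^ 2 = l ^ 4 := by field_simp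
  rw [hC'] at hC
  have hG := sum_range_one_div_two_pow_le n
  set S := ∑ k ∈ Finset.range n, totalCost e (k + 1) / 2 ^ k
  set G := ∑ k ∈ Finset.range n, (1 : ℝ) / 2 ^ k
  have hT : 0 ≤ totalCost e n / 2 ^ n :=
    div_nonneg (Finset.sum_nonneg fun i _ => cost_nonneg e i) (by positivity)
  have hlast' : M / 2 ^ n * (128 * m * l + (totalCost e n + 8 * 2 ^ n + t)) =
      128 * m * (m / 2 ^ n) + M * (totalCost e n / 2 ^ n + 8 + t * (1 / 2 ^ n)) := by
    rw [hM]; field_simp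
  rw [hlast'] at hlast
  -- By the choice of the last level, the mean number of dots in the band is O(m l).
  have hmn : m / 2 ^ n ≤ 2 * l := by
    rw [hM, div_lt_iff₀ hl0, pow_succ] at h2
    rw [div_le_iff₀ (by positivity)]
    linarith
  have hp : (1 : ℝ) / 2 ^ n ≤ 1 := by
    rw [div_le_one (by positivity)]; exact one_le_pow₀ one_le_two
  have hl2 : l ^ 2 ≤ l ^ 4 := pow_le_pow_right₀ hl (by norm_num)
  have hl4 : 1 ≤ l ^ 4 := one_le_pow₀ hl
  have hl3 : l ≤ l ^ 3 := le_self_pow₀ hl (by norm_num)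
  have hMl : M * l ^ 4 = m * l ^ 3 := by rw [hM]; field_simp
  -- With T = `totalCost e n / 2 ^ n`, `hS` and `hC` give S + 2T ≤ 12 l⁴, hence 9S + T ≤ 108 l⁴ and
  -- 134 = 2 + 108 + 16 + 8. The multiples of `t` are 1 + 2 + 1.
  have e1 : M * (2 * l ^ 2 + t) + M * (9 * S + n * 16 + t * G) +
      M * (totalCost e n / 2 ^ n + 8 + t * (1 / 2 ^ n)) ≤ M * (134 * l ^ 4 + 4 * t) := by
    rw [← mul_add, ← mul_add]
    refine mul_le_mul_of_nonneg_left ?_ hM0.le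
    have g1 : t * G ≤ t * 2 := mul_le_mul_of_nonneg_left hG ht
    have g2 : t * (1 / 2 ^ n) ≤ t * 1 := mul_le_mul_of_nonneg_left hp ht
    linarith
  have e2 : 128 * m * (m / 2 ^ n) ≤ 256 * (m * l ^ 3) := by
    have : m * (m / 2 ^ n) ≤ m * (2 * l ^ 3) :=
      mul_le_mul_of_nonneg_left (by linarith) hm.le
    linarith
  have e3 : M * (134 * l ^ 4 + 4 * t) = 134 * (m * l ^ 3) + 4 * M * t := by
    rw [← hMl]; ring
  linarith

/-- The exceptional events are one for the initial count, one for each of the n steps and one for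
the final band; outside them the level bounds hold for the code of every profile at once. -/
theorem IsPathSurplusProblem.tail_of_levels [IsProbabilityMeasure P]
    (h : IsPathSurplusProblem P m blue red) (hm : 0 < m) {l : ℝ} (hl : 1 ≤ l) {n : ℕ}
    (h1 : 2 ^ n ≤ m / l) (h2 : m / l < 2 ^ (n + 1)) (hn : (n : ℝ) ≤ l ^ 4) {t : ℝ} (ht : 0 ≤ t) :
    P.real {ω | 390 * m * l ^ 3 + 4 * (m / l) * t < (maxSurplus m (blue ω) (red ω) : ℝ)} ≤
      (n + 2) * Real.exp (-t) := by
  have hl0 : 0 < l := by linarith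
  set δ : ℝ := 1 / l ^ 2 with hδ'
  have hδ : 0 < δ := by positivity
  set B : ℕ := ⌈(2 : ℝ) ^ n * (5 + 1 / δ ^ 2)⌉₊
  -- This makes δ (θ_k w_{k+1})² = 1, so the variance term at level k is exactly 8 times the cost.
  let θ : ℕ → ℝ := fun k => 2 ^ k * l / m
  have hθ0 : ∀ k, 0 < θ k := fun k => by positivity
  have hθ1 : ∀ k ≤ n, θ k ≤ 1 := by
    intro k hk
    have h3 : (2 : ℝ) ^ k ≤ 2 ^ n := pow_le_pow_right₀ one_le_two hk
    rw [le_div_iff₀ hl0] at h1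
    rw [div_le_one hm]
    nlinarith
  have hθi : ∀ k, m / l / 2 ^ k = (θ k)⁻¹ := fun k => by
    simp only [θ]; field_simp
  let A₀ : Set Ω := {ω | 2 * θ 0 ^ 2 * m ^ 2 + t ≤
    θ 0 * net (blue ω) (red ω) (belowInd m fun _ => 0)}
  let A : ℕ → Set Ω := fun k => {ω | ∃ e : ℕ → ℕ → ℤ, IsCode e ∧
    (∀ i < k + 1, ∀ j, |e i j| ≤ B) ∧ 8 * δ * (θ k * width m (k + 1)) ^ 2 * cost e k +
      (totalCost e (k + 1) + 8 * 2 ^ (k + 1) + t) ≤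
      θ k * net (blue ω) (red ω) (fun p => belowInd m (approx m δ e (k + 1)) p -
        belowInd m (approx m δ e k) p)}
  let A₁ : Set Ω := {ω | ∃ e : ℕ → ℕ → ℤ, IsCode e ∧ (∀ i < n, ∀ j, |e i j| ≤ B) ∧
    4 * θ n * (32 * m ^ 2 / 2 ^ n) + (totalCost e n + 8 * 2 ^ n + t) ≤
      θ n * (dotSum (blue ω) ((bandRegion m δ e n).indicator 1) +
        dotSum (red ω) ((bandRegion m δ e n).indicator 1))}
  have hA₀ : P.real A₀ ≤ Real.exp (-t) :=
    h.initial_tail hm (hθ0 0).le (hθ1 0 (Nat.zero_le n)) measurable_const t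
  have hA : ∀ k < n, P.real (A k) ≤ Real.exp (-t) := by
    intro k hk
    refine measureReal_exists_code_le (k + 1) B
      (X := fun e ω => θ k * net (blue ω) (red ω) (fun p =>
        belowInd m (approx m δ e (k + 1)) p - belowInd m (approx m δ e k) p))
      (b := fun e => 8 * δ * (θ k * width m (k + 1)) ^ 2 * cost e k)
      (fun e he s => h.step_tail hm hδ.le (hθ0 k).le (hθ1 k hk.le) he k s) (fun e e' hee => ?_) t
    have c1 : approx m δ e (k + 1) = approx m δ e' (k + 1) := approx_congr hee
    have c2 : approx m δ e k = approx m δ e' k := approx_congr fun i hi => hee i (by omega)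
    have c3 : cost e k = cost e' k := Finset.sum_congr rfl fun j _ => by rw [hee k (by omega)]
    simp only [c1, c2, c3, and_self]
  have hA₁ : P.real A₁ ≤ Real.exp (-t) := by
    refine measureReal_exists_code_le n B
      (X := fun e ω => θ n * (dotSum (blue ω) ((bandRegion m δ e n).indicator 1) +
        dotSum (red ω) ((bandRegion m δ e n).indicator 1)))
      (b := fun _ => 4 * θ n * (32 * m ^ 2 / 2 ^ n))
      (fun e he s => h.band_tail hm δ (hθ0 n).le (hθ1 n le_rfl) e n s) (fun e e' hee => ?_) t
    simp only [bandRegion, approx_congr (m := m) (δ := δ) hee, and_self]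
  have hsub : {ω | 390 * m * l ^ 3 + 4 * (m / l) * t < (maxSurplus m (blue ω) (red ω) : ℝ)} ⊆
      (A₀ ∪ ⋃ k ∈ Finset.range n, A k) ∪ A₁ := by
    intro ω hω
    rw [Set.mem_ofPred_eq] at hω
    by_contra hnot
    simp only [Set.mem_union, Set.mem_iUnion, not_or, not_exists] at hnot
    obtain ⟨⟨n0, nk⟩, n1⟩ := hnot
    obtain ⟨g, hg, hmax⟩ := exists_profile_eq_maxSurplus hm.le (blue ω) (red ω)
    have hcode : IsCode (code m δ g) := fun i j hij => code_of_lt hij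
    have hB : ∀ i < n, ∀ j, |code m δ g i j| ≤ (B : ℤ) :=
      fun i hi j => abs_code_le hg hm hδ hi.le j
    have key := net_belowInd_le_of_levels hg hm hl h2 hn ht (blue ω) (red ω) ?_ ?_ ?_
    · rw [hmax, cast_profileSurplus] at hω
      exact absurd hω (not_lt.2 key)
    · have h3' : ¬ (2 * θ 0 ^ 2 * m ^ 2 + t ≤
          θ 0 * net (blue ω) (red ω) (belowInd m fun _ => 0)) := n0
      have h3 := (not_le.1 h3').le
      have h4 := hθi 0
      rw [pow_zero, div_one] at h4
      rw [h4, ← div_eq_inv_mul, le_div_iff₀ (hθ0 0), mul_comm]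
      refine h3.trans (le_of_eq ?_)
      simp only [θ]
      field_simp
    · intro k hk
      have h3 : ¬ _ := fun H => nk k (Finset.mem_range.2 hk)
        ⟨code m δ g, hcode, fun i hi j => hB i (by omega) j, H⟩
      have h4 := (not_le.1 h3).le
      rw [hθi, ← div_eq_inv_mul, le_div_iff₀ (hθ0 k), mul_comm]
      refine h4.trans (le_of_eq ?_)
      have h5 : δ * (θ k * width m (k + 1)) ^ 2 = 1 := by
        simp only [hδ', θ, width, pow_succ (2 : ℝ) k]
        field_simp
      rw [show 8 * δ * (θ k * width m (k + 1)) ^ 2 * cost (code m δ g) k =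
        8 * (δ * (θ k * width m (k + 1)) ^ 2) * cost (code m δ g) k by ring, h5, mul_one]
    · have h3 : ¬ _ := fun H => n1 ⟨code m δ g, hcode, hB, H⟩
      have h4 := (not_le.1 h3).le
      rw [hθi, ← div_eq_inv_mul, le_div_iff₀ (hθ0 n), mul_comm]
      refine h4.trans (le_of_eq ?_)
      congr 1
      simp only [θ]
      field_simp
      ring
  refine (measureReal_mono hsub (measure_ne_top _ _)).trans ?_
  refine (measureReal_union_le _ _).trans ?_
  have hU : P.real (⋃ k ∈ Finset.range n, A k) ≤ n * Real.exp (-t) := by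
    refine (measureReal_biUnion_finset_le _ _).trans ?_
    refine (Finset.sum_le_card_nsmul _ _ _ fun k hk => hA k (Finset.mem_range.1 hk)).trans ?_
    rw [Finset.card_range, nsmul_eq_mul]
  have := measureReal_union_le (μ := P) A₀ (⋃ k ∈ Finset.range n, A k)
  linarith

/-- The tail bound in terms of the base-2 logarithm. -/
theorem IsPathSurplusProblem.tail [IsProbabilityMeasure P]
    (h : IsPathSurplusProblem P m blue red) (hm : 2 ≤ m) {α : ℝ} (hα : 800 ≤ α) :
    P.real {ω | α * m * (Real.logb 2 m) ^ (0.75 : ℝ) ≤ (maxSurplus m (blue ω) (red ω) : ℝ)} ≤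
      (2 : ℝ) ^ (-(1 / 16 * α * Real.logb 2 m)) := by
  have hm0 : 0 < m := by linarith
  set L := Real.logb 2 m with hL
  have hL1 : 1 ≤ L := by
    rw [hL, Real.le_logb_iff_rpow_le one_lt_two hm0, Real.rpow_one]; exact hm
  have hL0 : 0 ≤ L := by linarith
  set l := L ^ (1 / 4 : ℝ) with hldef
  have hl : 1 ≤ l := Real.one_le_rpow hL1 (by norm_num)
  have hl0 : 0 < l := by linarith
  have hl4 : l ^ 4 = L := by
    rw [hldef, ← Real.rpow_natCast, ← Real.rpow_mul hL0]; norm_num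
  have hl3 : L ^ (0.75 : ℝ) = l ^ 3 := by
    rw [hldef, ← Real.rpow_natCast, ← Real.rpow_mul hL0]; norm_num
  have hmL : (2 : ℝ) ^ L = m := Real.rpow_logb two_pos (by norm_num) hm0
  have hlog2 : (1 / 2 : ℝ) < Real.log 2 := by linarith [Real.log_two_gt_d9]
  have hlog2' : Real.log 2 < 1 := by linarith [Real.log_two_lt_d9]
  have hlm : 1 ≤ m / l := by
    rw [le_div_iff₀ hl0, one_mul, ← hmL, ← hl4, Real.rpow_def_of_pos two_pos]
    have e1 := Real.add_one_le_exp (Real.log 2 * l ^ 4)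
    have e2 : l ^ 2 ≤ l ^ 4 := pow_le_pow_right₀ hl (by norm_num)
    nlinarith [sq_nonneg (l - 1)]
  obtain ⟨n, hn1, hn2⟩ := exists_nat_pow_near hlm (one_lt_two (α := ℝ))
  have hn : (n : ℝ) ≤ l ^ 4 := by
    rw [hl4, hL, Real.le_logb_iff_rpow_le one_lt_two hm0, Real.rpow_natCast]
    exact hn1.trans (div_le_self hm0.le hl)
  -- With t = α l⁴/8 the deviation term 4(m/l)t is half of α m l³; the other half exceeds 390 m l³
  -- since α ≥ 800.
  have ht : 0 ≤ α * l ^ 4 / 8 := by positivity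
  have key := h.tail_of_levels hm0 hl hn1 hn2 hn ht
  rw [hl3]
  have hsub : {ω | α * m * l ^ 3 ≤ (maxSurplus m (blue ω) (red ω) : ℝ)} ⊆
      {ω | 390 * m * l ^ 3 + 4 * (m / l) * (α * l ^ 4 / 8) <
        (maxSurplus m (blue ω) (red ω) : ℝ)} := by
    intro ω hω
    rw [Set.mem_ofPred_eq] at hω ⊢
    refine lt_of_lt_of_le ?_ hω
    have e1 : 4 * (m / l) * (α * l ^ 4 / 8) = α / 2 * (m * l ^ 3) := by
      field_simp; ring
    have e2 : 0 < m * l ^ 3 := by positivity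
    rw [e1]
    nlinarith
  refine (measureReal_mono hsub (measure_ne_top _ _)).trans (key.trans ?_)
  have hL4 : 1 ≤ l ^ 4 := by rw [hl4]; exact hL1
  rw [← hl4, Real.rpow_def_of_pos two_pos]
  -- The number of events is absorbed by half of the exponent, as 3 ≤ α/16.
  have e1 : (n : ℝ) + 2 ≤ Real.exp (3 * l ^ 4) := by
    linarith [Real.add_one_le_exp (3 * l ^ 4)]
  refine (mul_le_mul_of_nonneg_right e1 (Real.exp_pos _).le).trans ?_
  rw [← Real.exp_add]
  refine Real.exp_le_exp.2 ?_
  have e3 : 0 ≤ α * l ^ 4 := by positivity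
  have e4 : Real.log 2 * (α * l ^ 4) ≤ 1 * (α * l ^ 4) :=
    mul_le_mul_of_nonneg_right hlog2'.le e3
  have e5 : 800 * l ^ 4 ≤ α * l ^ 4 := mul_le_mul_of_nonneg_right hα (by linarith)
  linarith

/-- A random variable with a geometric tail beyond `A` has a bounded mean. -/
theorem integral_le_of_tail [IsProbabilityMeasure P] {X : Ω → ℝ} (hX : AEMeasurable X P)
    (h0 : ∀ ω, 0 ≤ X ω) {A s : ℝ} (hA : 0 ≤ A) (hs : 0 < s)
    (ht : ∀ x, A ≤ x → P.real {ω | x ≤ X ω} ≤ Real.exp (-(x / s))) :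
    Integrable X P ∧ ∫ ω, X ω ∂P ≤ A + s := by
  have hle : ∫⁻ ω, ENNReal.ofReal (X ω) ∂P ≤ ENNReal.ofReal (A + s) := by
    rw [lintegral_eq_lintegral_meas_le P (Filter.Eventually.of_forall h0) hX,
      ← Set.Ioc_union_Ioi_eq_Ioi hA]
    refine (lintegral_union_le _ _ _).trans ?_
    rw [ENNReal.ofReal_add hA hs.le]
    refine add_le_add ?_ ?_
    · refine (lintegral_mono fun x => prob_le_one).trans ?_
      simp
    · have hi : IntegrableOn (fun x => Real.exp (-(1 / s) * x)) (Set.Ioi A) :=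
        integrableOn_exp_mul_Ioi (by rw [neg_lt_zero]; positivity) A
      have hb : ∫⁻ x in Set.Ioi A, P {ω | x ≤ X ω} ≤
          ∫⁻ x in Set.Ioi A, ENNReal.ofReal (Real.exp (-(1 / s) * x)) := by
        refine setLIntegral_mono (by fun_prop) fun x hx => ?_
        rw [← ofReal_measureReal]
        refine ENNReal.ofReal_le_ofReal ((ht x (le_of_lt hx)).trans (le_of_eq ?_))
        congr 1
        ring
      refine hb.trans ?_
      rw [← ofReal_integral_eq_lintegral_ofReal hi
        (Filter.Eventually.of_forall fun x => (Real.exp_pos _).le),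
        integral_exp_mul_Ioi (by rw [neg_lt_zero]; positivity)]
      refine ENNReal.ofReal_le_ofReal ?_
      have e1 : Real.exp (-(1 / s) * A) ≤ 1 := by
        rw [Real.exp_le_one_iff, neg_mul, neg_nonpos]; positivity
      have e2 : -Real.exp (-(1 / s) * A) / -(1 / s) = s * Real.exp (-(1 / s) * A) := by
        field_simp
      rw [e2]
      nlinarith
  have hint : Integrable X P := by
    refine ⟨hX.aestronglyMeasurable, ?_⟩
    rw [hasFiniteIntegral_iff_ofReal (Filter.Eventually.of_forall h0)]
    exact hle.trans_lt ENNReal.ofReal_lt_top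
  refine ⟨hint, ?_⟩
  rw [integral_eq_lintegral_of_nonneg_ae (Filter.Eventually.of_forall h0)
    hX.aestronglyMeasurable]
  exact ENNReal.toReal_le_of_le_ofReal (by linarith) hle

theorem aemeasurable_comp_dots {F : Dots × Dots → ℝ} (hF : Measurable F)
    (hp : AEMeasurable (fun ω => (blue ω, red ω)) P) :
    AEMeasurable (fun ω => F (blue ω, red ω)) P :=
  hF.comp_aemeasurable hp

theorem IsPathSurplusProblem.aemeasurable_maxSurplus (h : IsPathSurplusProblem P m blue red)
    (hm : 0 ≤ m) : AEMeasurable (fun ω => (maxSurplus m (blue ω) (red ω) : ℝ)) P :=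
  aemeasurable_comp_dots (measurable_maxSurplus hm)
    (h.blue_dots.aemeasurable.prodMk h.red_dots.aemeasurable)

theorem IsPathSurplusProblem.integral_le [IsProbabilityMeasure P]
    (h : IsPathSurplusProblem P m blue red) (hm : 2 ≤ m) :
    Integrable (fun ω => (maxSurplus m (blue ω) (red ω) : ℝ)) P ∧
      ∫ ω, (maxSurplus m (blue ω) (red ω) : ℝ) ∂P ≤
        1000 * m * (Real.logb 2 m) ^ (0.75 : ℝ) := by
  have hm0 : 0 < m := by linarith
  have hL1 : 1 ≤ Real.logb 2 m := by
    rw [Real.le_logb_iff_rpow_le one_lt_two hm0, Real.rpow_one]; exact hm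
  have hR0 : 0 < (Real.logb 2 m) ^ (0.75 : ℝ) := Real.rpow_pos_of_pos (by linarith) _
  have htail := fun α (hα : 800 ≤ α) => h.tail hm hα
  generalize (Real.logb 2 m) ^ (0.75 : ℝ) = R at hR0 htail ⊢
  have hb0 : 0 < m * R := mul_pos hm0 hR0
  have hX := h.aemeasurable_maxSurplus hm0.le
  have h0 : ∀ ω, (0 : ℝ) ≤ maxSurplus m (blue ω) (red ω) := fun ω =>
    Int.cast_nonneg (maxSurplus_nonneg hm0.le _ _)
  -- Take α = x/(mR) in the tail bound; 1/32 comes from 1/16, log 2 > 1/2 and `hL1`. The mean is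
  -- then at most (800 + 32) m R.
  have ht : ∀ x, 800 * (m * R) ≤ x → P.real {ω | x ≤ (maxSurplus m (blue ω) (red ω) : ℝ)} ≤
      Real.exp (-(x / (32 * (m * R)))) := by
    intro x hx
    have hα : 800 ≤ x / (m * R) := by rwa [le_div_iff₀ hb0]
    have h1 := htail _ hα
    have h2 : x / (m * R) * m * R = x := by field_simp
    rw [h2] at h1
    refine h1.trans ?_
    rw [Real.rpow_def_of_pos two_pos]
    refine Real.exp_le_exp.2 ?_
    have hlog2 : (1 / 2 : ℝ) < Real.log 2 := by linarith [Real.log_two_gt_d9]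
    have h3 : x / (32 * (m * R)) = 1 / 32 * (x / (m * R)) := by field_simp
    have h4 : x / (m * R) * 1 ≤ x / (m * R) * Real.logb 2 m :=
      mul_le_mul_of_nonneg_left hL1 (by linarith)
    rw [h3]
    nlinarith
  obtain ⟨hi, hle⟩ := integral_le_of_tail hX h0 (A := 800 * (m * R)) (s := 32 * (m * R))
    (by positivity) (by positivity) ht
  exact ⟨hi, by linarith⟩

end

end PathSurplus

end

theorem mainTheorem2 :
    (∃ α₀ : ℝ, 0 < α₀ ∧ ∃ c : ℝ, 0 < c ∧
      ∀ (m : ℝ), 2 ≤ m →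
      ∀ (Ω : Type*) [MeasurableSpace Ω] (P : MeasureTheory.Measure Ω)
        [MeasureTheory.IsProbabilityMeasure P] (blue red : Ω → PathSurplus.Dots),
        PathSurplus.IsPathSurplusProblem P m blue red →
        ∀ α : ℝ, α₀ ≤ α →
          P.real {ω | α * m * (Real.logb 2 m) ^ (0.75 : ℝ) ≤
              (PathSurplus.maxSurplus m (blue ω) (red ω) : ℝ)} ≤
            (2 : ℝ) ^ (-(c * α * Real.logb 2 m))) ∧
    (∃ C : ℝ, 0 < C ∧
      ∀ (m : ℝ), 2 ≤ m →
      ∀ (Ω : Type*) [MeasurableSpace Ω] (P : MeasureTheory.Measure Ω)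
        [MeasureTheory.IsProbabilityMeasure P] (blue red : Ω → PathSurplus.Dots),
        PathSurplus.IsPathSurplusProblem P m blue red →
          MeasureTheory.Integrable
            (fun ω => (PathSurplus.maxSurplus m (blue ω) (red ω) : ℝ)) P ∧
          ∫ ω, (PathSurplus.maxSurplus m (blue ω) (red ω) : ℝ) ∂P ≤
            C * m * (Real.logb 2 m) ^ (0.75 : ℝ)) := by
  refine ⟨⟨800, by norm_num, 1 / 16, by norm_num, ?_⟩, 1000, by norm_num, ?_⟩
  · intro m hm Ω _ P _ blue red h α hα
    exact h.tail hm hα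
  · intro m hm Ω _ P _ blue red h
    exact h.integral_le hm
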